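/- Let $P_n$ be the path on $n\ge 1$ vertices. A sequence of vertices $x_1,x_2,\ldots$ of a finite graph $G=(V,E)$ determines a burning process: at time $0$ no vertex burns; in each round $t\ge 1$ every vertex with a neighbour burning at the end of round $t-1$ starts burning, $x_t$ starts burning, and burning vertices keep burning. The burning number $b(G)$ is the minimum number of rounds after which all vertices can be burning when in each round $x_t$ is a vertex not burning at the moment of selection, as long as there is such a vertex. Consider three random choices of $(x_t)_{t\ge1}$: given $x_1,\ldots,x_{t-1}$, the vertex $x_t$ is uniformly distributed on 1. $V$; 2. the set of vertices not in $\{x_1,\ldots,x_{t-1}\}$; 3. the set of vertices that are not burning at the moment of selection (an arbitrary vertex if this set is empty; this does not affect what follows). Let $b_j(G)$ ($j=1,2,3$) be the first time at which all vertices are burning in the $j$-th process, and, for $G = P_n$, $c_j(P_n)=b_j(P_n)/b(P_n)$. The selection in round $t$ may be taken to happen before, or after, the fire spreads in that round; the theorem holds under either convention. The three processes on $P_n$ may be defined on any common probability space. A sequence of events holds asymptotically almost surely (a.a.s.) if its probability tends to $1$ as $n\to\infty$; "a.a.s. $A_n=(1+o(1))B_n$" means that for every $\varepsilon>0$ a.a.s.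 $|A_n-B_n|\le\varepsilon B_n$; "a.a.s. $A_n=\Theta(B_n)$" means that there are constants $c,C>0$ such that a.a.s. $cB_n\le A_n\le CB_n$. **Theorem 1.4.** A.a.s. the following holds: (i) $b_1(P_n)=(1+o(1))\,b_2(P_n)=(1+o(1))\sqrt{n\log n/2}$, and thus $c_1(P_n)=(1+o(1))\,c_2(P_n)=(1+o(1))\sqrt{\log n/2}$; (ii) $b_3(P_n)=\Theta(\sqrt n)$, and thus $c_3(P_n)=\Theta(1)$. -/

import Mathlib

open MeasureTheory ProbabilityTheory Filter Topology

namespace Burning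

noncomputable section

/-! Throughout, a sequence of selected vertices is indexed from `0`: `x i` is the vertex selected
in round `i + 1` of the process. -/

section Selection

variable {V : Type*}

/-- One round of spreading: all vertices of `B` together with all their neighbours. -/
def spread (G : SimpleGraph V) (B : Set V) : Set V :=
  B ∪ {v | ∃ u ∈ B, G.Adj u v}

/-- The set of vertices burning at the end of round `t` when the vertices `x 0, x 1, …` are
selected in rounds `1, 2, …`. In round `t + 1` the fire spreads from the vertices that were burning
at the end of round `t`, and the selected vertex `x t` starts burning. -/
def burning (G : SimpleGraph V) (x : ℕ → V) : ℕ → Set V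
  | 0 => ∅
  | t + 1 => insert (x t) (spread G (burning G x t))

/-- The first time at which all vertices are burning. (If `G` is finite and connected, such a time
exists for every `x`.) -/
def burningTime (G : SimpleGraph V) (x : ℕ → V) : ℕ :=
  sInf {t | burning G x t = Set.univ}

/-- The two ways to read "not burning when the vertex of this round is selected": the selection is
made before, or after, the fire spreads in that round. -/
inductive Timing
  | beforeSpread
  | afterSpread

/-- The vertices that are not burning when the vertex `x t` of round `t + 1` is to be selected. -/
def unburnt (s : Timing) (G : SimpleGraph V) (x : ℕ → V) (t : ℕ) : Set V :=
  match s with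
  | Timing.beforeSpread => (burning G x t)ᶜ
  | Timing.afterSpread => (spread G (burning G x t))ᶜ

/-- A legal sequence of the deterministic burning process: in every round an unburnt vertex is
selected, if there is one. -/
def IsLegal (s : Timing) (G : SimpleGraph V) (x : ℕ → V) : Prop :=
  ∀ t, (unburnt s G x t).Nonempty → x t ∈ unburnt s G x t

/-- The burning number: the minimum number of rounds in which a legal sequence burns all
vertices. -/
def burningNumber (s : Timing) (G : SimpleGraph V) : ℕ :=
  sInf {k | ∃ x, IsLegal s G x ∧ burning G x k = Set.univ}

/-- The set from which the vertex `x t` of round `t + 1` is selected uniformly at random, for the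
first process: all vertices. -/
def pool₁ (_x : ℕ → V) (_t : ℕ) : Set V := Set.univ

/-- The same for the second process: the vertices not selected before. -/
def pool₂ (x : ℕ → V) (t : ℕ) : Set V := {v | ∀ i < t, x i ≠ v}

/-- The same for the third process: the vertices that are not burning. -/
def pool₃ (s : Timing) (G : SimpleGraph V) (x : ℕ → V) (t : ℕ) : Set V := unburnt s G x t

open Classical in
/-- The law of the next selected vertex: uniform on the pool. Once the pool is empty, which happens
only when all vertices are burning or are about to burn in this round by spreading, so that the
selection is irrelevant, we let it be uniform on all vertices. -/
def stepLaw [MeasurableSpace V] (pool : (ℕ → V) → ℕ → Set V) (x : ℕ → V) (t : ℕ) : Measure V :=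
  uniformOn (if (pool x t).Nonempty then pool x t else Set.univ)

/-- Extend a finite history `h 0, …, h n` to an infinite sequence (in an irrelevant way). -/
def extendHistory (n : ℕ) (h : Finset.Iic n → V) : ℕ → V :=
  fun i => h ⟨min i n, Finset.mem_Iic.2 (min_le_right i n)⟩

section Law

variable [Finite V] [Nonempty V] [MeasurableSpace V] [MeasurableSingletonClass V]

instance stepLaw_isProbabilityMeasure (pool : (ℕ → V) → ℕ → Set V) (x : ℕ → V) (t : ℕ) :
    IsProbabilityMeasure (stepLaw pool x t) := by
  unfold stepLaw
  split_ifs with h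
  · exact isProbabilityMeasure_uniformOn (Set.toFinite _) h
  · exact isProbabilityMeasure_uniformOn (Set.toFinite _) Set.univ_nonempty

/-- The transition kernel: given the selections `h 0, …, h n` of the first `n + 1` rounds, the
law of the selection of the next round. -/
def stepKernel (pool : (ℕ → V) → ℕ → Set V) (n : ℕ) : Kernel (Finset.Iic n → V) V :=
  Kernel.ofFunOfCountable fun h => stepLaw pool (extendHistory n h) (n + 1)

instance stepKernel_isMarkovKernel (pool : (ℕ → V) → ℕ → Set V) (n : ℕ) :
    IsMarkovKernel (stepKernel pool n) :=
  ⟨fun h => stepLaw_isProbabilityMeasure pool (extendHistory n h) (n + 1)⟩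

/-- The law of the infinite random sequence of selected vertices, in which the vertex of each round
is selected, given all earlier selections, uniformly at random from the pool of that round. -/
def processLaw (pool : (ℕ → V) → ℕ → Set V) : Measure (ℕ → V) :=
  Kernel.trajMeasure (X := fun _ => V) (stepLaw pool (fun _ => Classical.arbitrary V) 0)
    (stepKernel pool)

end Law

end Selection

section Asymptotics

variable {Ω : ℕ → Type*} [∀ n, MeasurableSpace (Ω n)]

/-- The events `E n` hold asymptotically almost surely. -/
def AAS (P : ∀ n, Measure (Ω n)) (E : ∀ n, Set (Ω n)) : Prop :=
  Tendsto (fun n => P n (E n)) atTop (𝓝 1)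

/-- A.a.s. `A = (1 + o(1)) B`. -/
def AASEquiv (P : ∀ n, Measure (Ω n)) (A B : ∀ n, Ω n → ℝ) : Prop :=
  ∀ ε : ℝ, 0 < ε → AAS P fun n => {ω | |A n ω - B n ω| ≤ ε * B n ω}

/-- A.a.s. `A = Θ(B)`. -/
def AASTheta (P : ∀ n, Measure (Ω n)) (A B : ∀ n, Ω n → ℝ) : Prop :=
  ∃ c C : ℝ, 0 < c ∧ 0 < C ∧ AAS P fun n => {ω | c * B n ω ≤ A n ω ∧ A n ω ≤ C * B n ω}

end Asymptotics

/-- The first time all vertices of the path on `n + 1` vertices are burning, for the random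
sequence `X n` of selected vertices. -/
def bPath {Ω : ℕ → Type*} (X : ∀ n, Ω n → ℕ → Fin (n + 1)) (n : ℕ) (ω : Ω n) : ℝ :=
  (burningTime (SimpleGraph.pathGraph (n + 1)) (X n ω) : ℝ)

/-- The cost of drunkenness of the path on `n + 1` vertices. -/
def cPath {Ω : ℕ → Type*} (s : Timing) (X : ∀ n, Ω n → ℕ → Fin (n + 1)) (n : ℕ) (ω : Ω n) : ℝ :=
  bPath X n ω / (burningNumber s (SimpleGraph.pathGraph (n + 1)) : ℝ)

end

end Burning

/-
A vertex survives until the end of round `T` exactly when every selection avoids a ball around it,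
whose radius decreases from `T - 1` to `0`. On the path the sizes `1, 3, 5, …` of these balls add up
to `T ^ 2`. Since the pools contain every such ball that is still relevant, survival has probability
at most about `exp (-T ^ 2 / N)` on the path with `N` vertices, and about this large for the first
two processes, whose pools stay almost as large as the path. At `T ^ 2 = N log N / 2` this is
`1 / √N`. The union bound over `O(√N)` grid vertices at distance `ε T`, with `ε T` more rounds to
burn what lies between them, gives the upper bound on the burning time. The second moment method for
vertices at distance `2 T`, whose balls are disjoint so that they survive almost independently,
gives the lower bound.

In the third process the pool shrinks with the fire. If at most `(2 τ) ^ 2` vertices are unburnt,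
then a given set of `m ≈ τ / 41` vertices of a grid survives `20 τ` further rounds with probability
at most `exp (-50 m)`, while at most `2 ^ (τ / 5)` such sets have unburnt neighbourhoods to begin
with. Hence `O(τ)` rounds reduce the number of unburnt vertices to `τ ^ 2` with high probability,
and these numbers of rounds form a geometric sum of order `√N`.
-/
namespace Burning

open SimpleGraph (pathGraph pathGraph_adj pathGraph_preconnected)

section Spread

variable {V : Type*} {G : SimpleGraph V} {A B : Set V}

lemma subset_spread : A ⊆ spread G A :=
  Set.subset_union_left

lemma spread_mono : Monotone (spread G) := by
  rintro A B h v (hv | ⟨u, hu, huv⟩)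
  · exact Or.inl (h hv)
  · exact Or.inr ⟨u, h hu, huv⟩

lemma spread_iUnion {ι : Sort*} (A : ι → Set V) : spread G (⋃ i, A i) = ⋃ i, spread G (A i) := by
  ext v
  simp only [spread, Set.mem_union, Set.mem_iUnion, Set.mem_ofPred_eq]
  grind

lemma disjoint_spread_comm : Disjoint (spread G A) B ↔ Disjoint A (spread G B) := by
  have key : ∀ {A B : Set V}, Disjoint A (spread G B) → Disjoint (spread G A) B := by
    intro A B h
    rw [Set.disjoint_left] at h ⊢
    rintro v (hv | ⟨u, hu, huv⟩) hvB
    · exact h hv (Or.inl hvB)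
    · exact h hu (Or.inr ⟨v, hvB, huv.symm⟩)
  exact ⟨fun h => (key h.symm).symm, key⟩

lemma disjoint_iterate_spread_comm (k : ℕ) :
    Disjoint ((spread G)^[k] A) B ↔ Disjoint A ((spread G)^[k] B) := by
  induction k generalizing B with
  | zero => rfl
  | succ k ih =>
    rw [Function.iterate_succ_apply', disjoint_spread_comm, ih, Function.iterate_succ_apply]

lemma iterate_spread_biUnion (k : ℕ) (A : Set V) :
    (spread G)^[k] A = ⋃ v ∈ A, (spread G)^[k] {v} := by
  induction k with
  | zero => simp
  | succ k ih => simp only [Function.iterate_succ_apply', ih, spread_iUnion]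

end Spread

section Burning

variable {V : Type*} {G : SimpleGraph V} {S : Set V} {x : ℕ → V} {t : ℕ}

lemma dependsOn_burning (G : SimpleGraph V) (t : ℕ) :
    DependsOn (fun x => burning G x t) (Set.Iio t) := by
  induction t with
  | zero => exact fun _ _ _ => rfl
  | succ t ih =>
    intro x y h
    have hxy : burning G x t = burning G y t := ih.mono (Set.Iio_subset_Iio t.le_succ) h
    simp only [burning, h t t.lt_succ_self, hxy]

lemma dependsOn_unburnt (s : Timing) (G : SimpleGraph V) (t : ℕ) :
    DependsOn (fun x => unburnt s G x t) (Set.Iio t) := by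
  intro x y h
  have := dependsOn_burning G t h
  cases s <;> simp only [unburnt, this]

lemma unburnt_subset (s : Timing) (G : SimpleGraph V) (x : ℕ → V) (t : ℕ) :
    unburnt s G x t ⊆ (burning G x t)ᶜ := by
  cases s
  · exact subset_rfl
  · exact Set.compl_subset_compl.2 subset_spread

lemma compl_spread_burning_subset_unburnt (s : Timing) (G : SimpleGraph V) (x : ℕ → V) (t : ℕ) :
    (spread G (burning G x t))ᶜ ⊆ unburnt s G x t := by
  cases s
  · exact Set.compl_subset_compl.2 subset_spread
  · exact subset_rfl

lemma disjoint_burning_succ :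
    Disjoint S (burning G x (t + 1)) ↔ x t ∉ S ∧ Disjoint (spread G S) (burning G x t) := by
  rw [burning, Set.disjoint_insert_right, ← disjoint_spread_comm]

lemma burning_eq_biUnion (G : SimpleGraph V) (x : ℕ → V) (t : ℕ) :
    burning G x t = ⋃ i < t, (spread G)^[t - 1 - i] {x i} := by
  induction t with
  | zero => simp [burning]
  | succ t ih =>
    rw [burning, ih, Set.biUnion_lt_succ, Set.insert_eq, Set.union_comm]
    simp only [spread_iUnion, ← Function.iterate_succ_apply' (spread G), Nat.add_sub_cancel,
      Nat.sub_self, Function.iterate_zero_apply]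
    congr! 5 with i hi
    omega

lemma iterate_spread_burning_subset (G : SimpleGraph V) (x : ℕ → V) (t r : ℕ) :
    (spread G)^[r] (burning G x t) ⊆ burning G x (t + r) := by
  induction r with
  | zero => exact subset_rfl
  | succ r ih =>
    rw [Function.iterate_succ_apply']
    exact (spread_mono ih).trans (Set.subset_insert _ _)

lemma burning_mono (G : SimpleGraph V) (x : ℕ → V) : Monotone (burning G x) :=
  monotone_nat_of_le_succ fun _ => subset_spread.trans (Set.subset_insert _ _)

lemma apply_mem_burning {i : ℕ} (h : i < t) : x i ∈ burning G x t :=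
  burning_mono G x h (Set.mem_insert _ _)

lemma disjoint_iterate_spread_burning {r : ℕ} (h : Disjoint S (burning G x (t + r))) :
    Disjoint ((spread G)^[r] S) (burning G x t) :=
  (disjoint_iterate_spread_comm r).2 (h.mono_right (iterate_spread_burning_subset G x t r))

lemma exists_mem_iterate_spread (hG : G.Preconnected) (u v : V) :
    ∃ k, v ∈ (spread G)^[k] {u} := by
  obtain ⟨p⟩ := hG u v
  induction p with
  | nil => exact ⟨0, rfl⟩
  | @cons u u' v h _ ih =>
    obtain ⟨k, hk⟩ := ih
    refine ⟨k + 1, spread_mono.iterate k ?_ hk⟩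
    exact Set.singleton_subset_iff.2 (Or.inr ⟨u, rfl, h⟩)

lemma exists_burning_eq_univ [Finite V] (hG : G.Preconnected) (x : ℕ → V) :
    ∃ t, burning G x t = Set.univ := by
  have h : ∀ v, ∀ᶠ t in atTop, v ∈ burning G x t := by
    intro v
    obtain ⟨k, hk⟩ := exists_mem_iterate_spread hG (x 0) v
    filter_upwards [eventually_ge_atTop (1 + k)] with t ht
    refine burning_mono G x ht (iterate_spread_burning_subset G x 1 k ?_)
    exact spread_mono.iterate k (Set.singleton_subset_iff.2 (apply_mem_burning one_pos)) hk
  exact (eventually_all.2 h).exists.imp fun t ht => Set.eq_univ_of_forall ht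

lemma burningTime_le_iff [Finite V] (hG : G.Preconnected) :
    burningTime G x ≤ t ↔ burning G x t = Set.univ := by
  refine ⟨fun h => Set.univ_subset_iff.1 ?_, fun h => Nat.sInf_le h⟩
  have hT : burning G x (burningTime G x) = Set.univ := Nat.sInf_mem (exists_burning_eq_univ hG x)
  exact hT ▸ burning_mono G x h

end Burning

section LegalSequences

variable {V : Type*} {G : SimpleGraph V}

lemma exists_seq_of_dependsOn [Nonempty V] {P : (ℕ → V) → ℕ → V → Prop}
    (hP : ∀ t, DependsOn (fun x => P x t) (Set.Iio t)) (hex : ∀ x t, ∃ v, P x t v) :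
    ∃ x, ∀ t, P x t (x t) := by
  choose c hc using hex
  let X : ℕ → ℕ → V := fun t =>
    Nat.rec (fun _ => Classical.arbitrary V) (fun t x => Function.update x t (c x t)) t
  have hX : ∀ t i, i < t → X t i = c (X i) i := by
    intro t i hi
    induction t, Nat.succ_le_iff.2 hi using Nat.le_induction with
    | base => exact Function.update_self ..
    | succ t hit ih =>
      exact (Function.update_of_ne (by omega) _ _).trans (ih (by omega))
  refine ⟨fun t => c (X t) t, fun t => ?_⟩
  have h : P (X t) t = P (fun i => c (X i) i) t := hP t fun i hi => hX t i hi
  exact h ▸ hc (X t) t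

lemma exists_isLegal_burning_subset (s : Timing) (G : SimpleGraph V) (y : ℕ → V) :
    ∃ x, IsLegal s G x ∧ ∀ t, burning G y t ⊆ burning G x t := by
  have : Nonempty V := ⟨y 0⟩
  obtain ⟨x, hx⟩ : ∃ x : ℕ → V, ∀ t, ((unburnt s G x t).Nonempty → x t ∈ unburnt s G x t) ∧
      (y t ∈ unburnt s G x t → x t = y t) := by
    refine exists_seq_of_dependsOn (P := fun x t v =>
      ((unburnt s G x t).Nonempty → v ∈ unburnt s G x t) ∧ (y t ∈ unburnt s G x t → v = y t))
      (fun t x x' h => ?_) (fun x t => ?_)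
    · have h' : unburnt s G x t = unburnt s G x' t := dependsOn_unburnt s G t h
      simp only [h']
    · by_cases hy : y t ∈ unburnt s G x t
      · exact ⟨y t, fun _ => hy, fun _ => rfl⟩
      · rcases (unburnt s G x t).eq_empty_or_nonempty with hU | ⟨v, hv⟩
        · exact ⟨y t, fun h => absurd h (by simp [hU]), fun _ => rfl⟩
        · exact ⟨v, fun _ => hv, fun h => absurd h hy⟩
  refine ⟨x, fun t => (hx t).1, fun t => ?_⟩
  induction t with
  | zero => exact subset_rfl
  | succ t ih =>
    refine Set.insert_subset ?_ ((spread_mono ih).trans (Set.subset_insert _ _))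
    by_cases hy : y t ∈ unburnt s G x t
    · exact Or.inl ((hx t).2 hy).symm
    · exact Or.inr (not_not.1 fun h => hy (compl_spread_burning_subset_unburnt s G x t h))

lemma exists_isLegal_burning_burningNumber_eq_univ [Finite V] [Nonempty V] (s : Timing)
    (hG : G.Preconnected) :
    ∃ x, IsLegal s G x ∧ burning G x (burningNumber s G) = Set.univ := by
  obtain ⟨x, hx, -⟩ := exists_isLegal_burning_subset s G fun _ => Classical.arbitrary V
  obtain ⟨t, ht⟩ := exists_burning_eq_univ hG x
  exact Nat.sInf_mem (s := {k | ∃ x, IsLegal s G x ∧ burning G x k = Set.univ}) ⟨t, x, hx, ht⟩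

lemma burningNumber_le_of_burning_eq_univ (s : Timing) {y : ℕ → V} {k : ℕ}
    (hy : burning G y k = Set.univ) : burningNumber s G ≤ k := by
  obtain ⟨x, hx, h⟩ := exists_isLegal_burning_subset s G y
  exact Nat.sInf_le ⟨x, hx, Set.univ_subset_iff.1 (hy ▸ h k)⟩

end LegalSequences

section Law

variable {V : Type*} {pool : (ℕ → V) → ℕ → Set V} {E : Set (ℕ → V)} {t : ℕ}

lemma extendHistory_frestrictLe (n : ℕ) (x : ℕ → V) :
    ∀ i ∈ Set.Iio (n + 1),
      extendHistory n (Preorder.frestrictLe (π := fun _ => V) n x) i = x i := by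
  intro i hi
  simp only [extendHistory, Preorder.frestrictLe_apply, min_eq_left (Nat.lt_succ_iff.1 hi)]

lemma eq_frestrictLe_preimage_of_dependsOn {n : ℕ} (hE : DependsOn (· ∈ E) (Set.Iio (n + 1))) :
    E = Preorder.frestrictLe (π := fun _ => V) n ⁻¹' {h | extendHistory n h ∈ E} := by
  ext x
  exact (hE (extendHistory_frestrictLe n x)).symm.to_iff

lemma measurableSet_of_dependsOn [Finite V] [MeasurableSpace V] [MeasurableSingletonClass V]
    (hE : DependsOn (· ∈ E) (Set.Iio t)) : MeasurableSet E := by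
  rw [eq_frestrictLe_preimage_of_dependsOn (hE.mono (Set.Iio_subset_Iio t.le_succ))]
  exact Preorder.measurable_frestrictLe _ (Set.toFinite _).measurableSet

lemma stepLaw_congr [MeasurableSpace V] (hp : DependsOn (fun x => pool x t) (Set.Iio t))
    {x y : ℕ → V} (h : ∀ i ∈ Set.Iio t, x i = y i) : stepLaw pool x t = stepLaw pool y t := by
  have hxy : pool x t = pool y t := hp h
  rw [stepLaw, stepLaw, hxy]

lemma stepLaw_real_of_subset [Finite V] [MeasurableSpace V] [MeasurableSingletonClass V]
    {x : ℕ → V} {B : Set V} (hB : B ⊆ pool x t) :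
    (stepLaw pool x t).real B = B.ncard / (pool x t).ncard := by
  rcases B.eq_empty_or_nonempty with rfl | hne
  · simp
  classical
  have := Fintype.ofFinite V
  rw [stepLaw, if_pos (hne.mono hB), measureReal_def, ← Set.coe_toFinset B,
    ← Set.coe_toFinset (pool x t), uniformOn_apply_finset, Set.ncard_coe_finset,
    Set.ncard_coe_finset, Finset.inter_eq_right.2 (by simpa using hB), ENNReal.toReal_div]
  simp

variable [Finite V] [Nonempty V] [MeasurableSpace V] [MeasurableSingletonClass V]

instance processLaw_isProbabilityMeasure (pool : (ℕ → V) → ℕ → Set V) :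
    IsProbabilityMeasure (processLaw pool) := by
  unfold processLaw
  infer_instance

lemma processLaw_map_zero (pool : (ℕ → V) → ℕ → Set V) :
    (processLaw pool).map (fun x => x 0) =
      stepLaw pool (fun _ => Classical.arbitrary V) 0 := by
  have h : (fun x : ℕ → V => x 0) =
      (MeasurableEquiv.piUnique (fun _ : Finset.Iic 0 => V)) ∘
        Preorder.frestrictLe (π := fun _ => V) 0 := rfl
  unfold processLaw Kernel.trajMeasure
  rw [h, ← Measure.map_map (by fun_prop) (by fun_prop), Measure.map_comp _ _ (by fun_prop),
    Kernel.traj_map_frestrictLe, Kernel.partialTraj_self, Measure.id_comp,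
    Measure.map_map (by fun_prop) (by fun_prop), MeasurableEquiv.self_comp_symm, Measure.map_id]

lemma processLaw_inter_eq_setLIntegral (hp : DependsOn (fun x => pool x t) (Set.Iio t))
    (hE : DependsOn (· ∈ E) (Set.Iio t)) (B : Set V) :
    processLaw pool (E ∩ {x | x t ∈ B}) = ∫⁻ x in E, stepLaw pool x t B ∂(processLaw pool) := by
  have hB : MeasurableSet B := (Set.toFinite B).measurableSet
  rcases t with _ | n
  · have hc : ∀ x, stepLaw pool x 0 = stepLaw pool (fun _ => Classical.arbitrary V) 0 :=
      fun x => stepLaw_congr hp (by simp)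
    simp only [hc, lintegral_const, Measure.restrict_apply_univ]
    rcases E.eq_empty_or_nonempty with rfl | ⟨y, hy⟩
    · simp
    · obtain rfl : E = Set.univ := Set.eq_univ_of_forall fun z => (hE (by simp)).mp hy
      rw [Set.univ_inter, measure_univ, mul_one, ← processLaw_map_zero,
        Measure.map_apply (by fun_prop) hB]
      rfl
  · have hE' := eq_frestrictLe_preimage_of_dependsOn hE
    set H : Set (Finset.Iic n → V) := {h | extendHistory n h ∈ E}
    have hH : MeasurableSet H := (Set.toFinite _).measurableSet
    have hpre : E ∩ {x | x (n + 1) ∈ B} =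
        (fun x : ℕ → V => (Preorder.frestrictLe (π := fun _ => V) n x, x (n + 1))) ⁻¹'
          (H ×ˢ B) := by
      rw [hE']; rfl
    rw [hpre, ← Measure.map_apply (by fun_prop) (hH.prod hB)]
    unfold processLaw
    rw [← Kernel.map_frestrictLe_trajMeasure_compProd_eq_map_trajMeasure,
      Measure.compProd_apply_prod hH hB, setLIntegral_map hH
        (Kernel.measurable_coe _ hB) (by fun_prop), ← hE']
    refine lintegral_congr fun x => ?_
    change stepLaw pool _ _ B = _
    rw [stepLaw_congr hp (extendHistory_frestrictLe n x)]

lemma processLaw_real_inter_notMem_le (hp : DependsOn (fun x => pool x t) (Set.Iio t))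
    (hE : DependsOn (· ∈ E) (Set.Iio t)) {B : Set V} {q : ℝ}
    (hq : ∀ x ∈ E, q ≤ (stepLaw pool x t).real B) :
    (processLaw pool).real (E ∩ {x | x t ∉ B}) ≤ (1 - q) * (processLaw pool).real E := by
  rcases E.eq_empty_or_nonempty with rfl | ⟨y, hy⟩
  · simp
  have hq1 : 0 ≤ 1 - q := sub_nonneg.2 ((hq y hy).trans measureReal_le_one)
  have h : processLaw pool (E ∩ {x | x t ∈ Bᶜ}) ≤ ENNReal.ofReal (1 - q) * processLaw pool E := by
    rw [processLaw_inter_eq_setLIntegral hp hE, ← setLIntegral_const]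
    refine setLIntegral_mono measurable_const fun x hx => ?_
    rw [← ofReal_measureReal, probReal_compl_eq_one_sub (Set.toFinite B).measurableSet]
    exact ENNReal.ofReal_le_ofReal (by linarith [hq x hx])
  have := ENNReal.toReal_mono (by finiteness) h
  rwa [ENNReal.toReal_mul, ENNReal.toReal_ofReal hq1] at this

lemma le_processLaw_real_inter_notMem (hp : DependsOn (fun x => pool x t) (Set.Iio t))
    (hE : DependsOn (· ∈ E) (Set.Iio t)) {B : Set V} {q : ℝ} (hq1 : q ≤ 1)
    (hq : ∀ x ∈ E, (stepLaw pool x t).real B ≤ q) :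
    (1 - q) * (processLaw pool).real E ≤ (processLaw pool).real (E ∩ {x | x t ∉ B}) := by
  have h : ENNReal.ofReal (1 - q) * processLaw pool E ≤ processLaw pool (E ∩ {x | x t ∈ Bᶜ}) := by
    rw [processLaw_inter_eq_setLIntegral hp hE, ← setLIntegral_const]
    refine setLIntegral_mono' (measurableSet_of_dependsOn hE) fun x hx => ?_
    rw [← ofReal_measureReal (μ := stepLaw pool x t),
      probReal_compl_eq_one_sub (Set.toFinite B).measurableSet]
    exact ENNReal.ofReal_le_ofReal (by linarith [hq x hx])
  have := ENNReal.toReal_mono (by finiteness) h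
  rwa [ENNReal.toReal_mul, ENNReal.toReal_ofReal (by linarith)] at this

end Law

section Survival

variable {V : Type*} {G : SimpleGraph V} {pool : (ℕ → V) → ℕ → Set V} {E : Set (ℕ → V)}

/-- A rule for the pools is admissible on `G` if the pool of a round is determined by the earlier
selections and contains every vertex that the fire has not reached after spreading in that round.
The pools of all three processes are of this form. -/
structure IsAdmissible (G : SimpleGraph V) (pool : (ℕ → V) → ℕ → Set V) : Prop where
  dependsOn : ∀ t, DependsOn (fun x => pool x t) (Set.Iio t)
  compl_spread_subset : ∀ x t, (spread G (burning G x t))ᶜ ⊆ pool x t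

lemma isAdmissible_pool₁ (G : SimpleGraph V) : IsAdmissible G pool₁ :=
  ⟨fun _ _ _ _ => rfl, fun _ _ => Set.subset_univ _⟩

lemma isAdmissible_pool₂ (G : SimpleGraph V) : IsAdmissible G pool₂ where
  dependsOn t x y h := by
    ext v
    exact forall₂_congr fun i hi => by rw [h i hi]
  compl_spread_subset x t v hv i hi := by
    rintro rfl
    exact hv (subset_spread (apply_mem_burning hi))

lemma isAdmissible_pool₃ (s : Timing) (G : SimpleGraph V) : IsAdmissible G (pool₃ s G) :=
  ⟨dependsOn_unburnt s G, compl_spread_burning_subset_unburnt s G⟩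

lemma IsAdmissible.subset_of_disjoint (hp : IsAdmissible G pool) {S : Set V} {x : ℕ → V} {t : ℕ}
    (h : Disjoint (spread G S) (burning G x t)) : S ⊆ pool x t :=
  (disjoint_spread_comm.1 h).subset_compl_right.trans (hp.compl_spread_subset x t)

lemma dependsOn_disjoint_burning (G : SimpleGraph V) (S : Set V) (t : ℕ) :
    DependsOn (· ∈ {x | Disjoint S (burning G x t)}) (Set.Iio t) :=
  fun _ _ h => congrArg (Disjoint S) (dependsOn_burning G t h)

lemma dependsOn_mem_inter {F : Set (ℕ → V)} {t : ℕ} (hE : DependsOn (· ∈ E) (Set.Iio t))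
    (hF : DependsOn (· ∈ F) (Set.Iio t)) : DependsOn (· ∈ E ∩ F) (Set.Iio t) :=
  fun _ _ h => congrArg₂ And (hE h) (hF h)

variable [Finite V] [Nonempty V] [MeasurableSpace V] [MeasurableSingletonClass V]

lemma IsAdmissible.processLaw_real_inter_disjoint_burning_le (hp : IsAdmissible G pool) {s U : ℕ}
    (hE : DependsOn (· ∈ E) (Set.Iio s)) (hU : ∀ x ∈ E, ∀ t, s ≤ t → (pool x t).ncard ≤ U)
    (k : ℕ) (S : Set V) :
    (processLaw pool).real (E ∩ {x | Disjoint S (burning G x (s + k))}) ≤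
      Real.exp (-(∑ j ∈ Finset.range k, (((spread G)^[j] S).ncard : ℝ)) / U) *
        (processLaw pool).real (E ∩ {x | Disjoint ((spread G)^[k] S) (burning G x s)}) := by
  induction k generalizing S with
  | zero => simp
  | succ k ih =>
    set F := E ∩ {x | Disjoint (spread G S) (burning G x (s + k))} with hF
    have hstep : ∀ x ∈ F, (S.ncard / U : ℝ) ≤ (stepLaw pool x (s + k)).real S := by
      rintro x ⟨hxE, hx⟩
      have hS := hp.subset_of_disjoint hx
      rw [stepLaw_real_of_subset hS]
      rcases S.eq_empty_or_nonempty with rfl | hne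
      · simp
      · have : 0 < (pool x (s + k)).ncard := (Set.ncard_pos (Set.toFinite _)).2 (hne.mono hS)
        gcongr
        exact hU x hxE _ (by omega)
    have hEF : E ∩ {x | Disjoint S (burning G x (s + (k + 1)))} = F ∩ {x | x (s + k) ∉ S} := by
      ext x
      simp only [hF, ← add_assoc, disjoint_burning_succ, Set.mem_inter_iff, Set.mem_ofPred_eq]
      tauto
    calc (processLaw pool).real (E ∩ {x | Disjoint S (burning G x (s + (k + 1)))})
        ≤ (1 - S.ncard / U) * (processLaw pool).real F :=
          hEF ▸ processLaw_real_inter_notMem_le (hp.dependsOn _) (dependsOn_mem_inter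
            (hE.mono (Set.Iio_subset_Iio (by omega))) (dependsOn_disjoint_burning G _ _)) hstep
      _ ≤ Real.exp (-(S.ncard / U)) * _ :=
          mul_le_mul (Real.one_sub_le_exp_neg _) (ih (spread G S)) measureReal_nonneg
            (Real.exp_pos _).le
      _ = _ := by
          rw [← mul_assoc, ← Real.exp_add, Finset.sum_range_succ']
          simp only [Function.iterate_succ_apply, Function.iterate_zero_apply]
          congr 2
          ring

lemma IsAdmissible.le_processLaw_real_disjoint_burning (hp : IsAdmissible G pool) {u T : ℕ}
    (hu : ∀ x t, t < T → u ≤ (pool x t).ncard) {S : Set V}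
    (hS : ∀ j < T, ((spread G)^[j] S).ncard ≤ u) :
    ∏ j ∈ Finset.range T, (1 - ((spread G)^[j] S).ncard / u : ℝ) ≤
      (processLaw pool).real {x | Disjoint S (burning G x T)} := by
  induction T generalizing S with
  | zero => simp [burning]
  | succ T ih =>
    set F := {x | Disjoint (spread G S) (burning G x T)} with hF
    have hSu : S.ncard ≤ u := hS 0 T.succ_pos
    have hstep : ∀ x ∈ F, (stepLaw pool x T).real S ≤ (S.ncard / u : ℝ) := by
      intro x hx
      rw [stepLaw_real_of_subset (hp.subset_of_disjoint hx)]
      rcases S.eq_empty_or_nonempty with rfl | hne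
      · simp
      · have : 0 < u := ((Set.ncard_pos (Set.toFinite _)).2 hne).trans_le hSu
        gcongr
        exact hu x T T.lt_succ_self
    have hFS : F ∩ {x | x T ∉ S} = {x | Disjoint S (burning G x (T + 1))} := by
      ext x
      simp only [hF, disjoint_burning_succ, Set.mem_inter_iff, Set.mem_ofPred_eq, and_comm]
    have hSu1 : (S.ncard / u : ℝ) ≤ 1 := div_le_one_of_le₀ (by exact_mod_cast hSu) u.cast_nonneg
    rw [Finset.prod_range_succ', mul_comm, ← hFS]
    refine le_trans (mul_le_mul_of_nonneg_left ?_ (sub_nonneg.2 hSu1))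
      (le_processLaw_real_inter_notMem (hp.dependsOn T) (dependsOn_disjoint_burning G _ T)
        hSu1 hstep)
    exact ih (fun x t ht => hu x t (ht.trans T.lt_succ_self))
      fun j hj => hS (j + 1) (Nat.succ_lt_succ hj)

end Survival

lemma sum_range_two_mul_add_one (T : ℕ) : ∑ j ∈ Finset.range T, (2 * j + 1) = T ^ 2 := by
  induction T with
  | zero => rfl
  | succ T ih => rw [Finset.sum_range_succ, ih]; ring

lemma ncard_iterate_spread_of_pairwiseDisjoint {V : Type*} [Finite V] {G : SimpleGraph V} {k : ℕ}
    {S : Finset V} (h : (S : Set V).PairwiseDisjoint fun v => (spread G)^[k] {v}) :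
    ((spread G)^[k] S).ncard = ∑ v ∈ S, ((spread G)^[k] {v}).ncard := by
  rw [iterate_spread_biUnion, S.finite_toSet.ncard_biUnion (fun _ _ => Set.toFinite _) h,
    finsum_mem_coe_finset]

section Path

variable {n k L : ℕ} {u v : Fin (n + 1)}

lemma iterate_spread_pathGraph_singleton (k : ℕ) (v : Fin (n + 1)) :
    (spread (pathGraph (n + 1)))^[k] {v} = {w : Fin (n + 1) | w.val ≤ v + k ∧ v.val ≤ w + k} := by
  induction k with
  | zero =>
    ext w
    simp only [Function.iterate_zero_apply, Set.mem_singleton_iff, Set.mem_ofPred_eq, Fin.ext_iff]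
    omega
  | succ k ih =>
    ext w
    simp only [Function.iterate_succ_apply', ih, spread, pathGraph_adj, Set.mem_union,
      Set.mem_ofPred_eq]
    constructor
    · rintro (h | ⟨u, h, hu⟩) <;> omega
    · intro h
      rcases lt_trichotomy w.val v with hw | hw | hw
      · exact Or.inr ⟨⟨w + 1, by omega⟩, by dsimp only; omega, Or.inr rfl⟩
      · exact Or.inl (by omega)
      · exact Or.inr ⟨⟨w - 1, by omega⟩, by dsimp only; omega, Or.inl (by dsimp only; omega)⟩

lemma mem_iterate_spread_pathGraph_singleton :
    u ∈ (spread (pathGraph (n + 1)))^[k] {v} ↔ u.val ≤ v + k ∧ v.val ≤ u + k := by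
  rw [iterate_spread_pathGraph_singleton]; rfl

lemma ncard_iterate_spread_pathGraph_singleton (k : ℕ) (v : Fin (n + 1)) :
    ((spread (pathGraph (n + 1)))^[k] {v}).ncard = min (v + k) n + 1 - (v - k) := by
  have hv := v.isLt
  have hIcc : (spread (pathGraph (n + 1)))^[k] {v} =
      Finset.Icc (⟨v - k, by omega⟩ : Fin (n + 1)) ⟨min (v + k) n, by omega⟩ := by
    ext w
    simp only [mem_iterate_spread_pathGraph_singleton, Finset.coe_Icc, Set.mem_Icc, Fin.le_def]
    omega
  rw [hIcc, Set.ncard_coe_finset, Fin.card_Icc]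

lemma ncard_iterate_spread_pathGraph_singleton_le (k : ℕ) (v : Fin (n + 1)) :
    ((spread (pathGraph (n + 1)))^[k] {v}).ncard ≤ 2 * k + 1 := by
  rw [ncard_iterate_spread_pathGraph_singleton]
  omega

lemma succ_le_ncard_iterate_spread_pathGraph_singleton (hk : k ≤ n) (v : Fin (n + 1)) :
    k + 1 ≤ ((spread (pathGraph (n + 1)))^[k] {v}).ncard := by
  rw [ncard_iterate_spread_pathGraph_singleton]
  omega

lemma ncard_iterate_spread_pathGraph_singleton_of_interior (h₁ : k ≤ v.val) (h₂ : v + k ≤ n) :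
    ((spread (pathGraph (n + 1)))^[k] {v}).ncard = 2 * k + 1 := by
  rw [ncard_iterate_spread_pathGraph_singleton]
  omega

lemma disjoint_iterate_spread_pathGraph_singleton (h : u + 2 * k < v.val ∨ v + 2 * k < u.val) :
    Disjoint ((spread (pathGraph (n + 1)))^[k] {u}) ((spread (pathGraph (n + 1)))^[k] {v}) := by
  refine Set.disjoint_left.2 fun w hu hv => ?_
  rw [mem_iterate_spread_pathGraph_singleton] at hu hv
  omega

/-- The vertices of the path in positions that are multiples of `L`. -/
def grid (n L : ℕ) : Finset (Fin (n + 1)) :=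
  {v | L ∣ v.val}

lemma mem_grid : v ∈ grid n L ↔ L ∣ v.val := by
  simp [grid]

lemma card_grid_le (n L : ℕ) : (grid n L).card ≤ n / L + 1 := by
  refine (Finset.card_le_card_of_injOn (fun v => v.val / L) (t := Finset.range (n / L + 1))
    (fun v _ => ?_) fun u hu v hv huv => ?_).trans_eq (Finset.card_range _)
  · exact Finset.mem_coe.2 (Finset.mem_range_succ_iff.2 (Nat.div_le_div_right (by omega)))
  · exact Fin.ext ((Nat.div_left_inj (mem_grid.1 hu) (mem_grid.1 hv)).1 huv)

lemma pairwiseDisjoint_grid (h : 2 * k < L) :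
    (grid n L : Set (Fin (n + 1))).PairwiseDisjoint fun v =>
      (spread (pathGraph (n + 1)))^[k] {v} := by
  intro u hu v hv huv
  refine disjoint_iterate_spread_pathGraph_singleton ?_
  obtain ⟨a, ha⟩ := mem_grid.1 hu
  obtain ⟨b, hb⟩ := mem_grid.1 hv
  rcases lt_trichotomy a b with hab | rfl | hab
  · left; nlinarith [Nat.mul_le_mul_left L (Nat.succ_le_of_lt hab)]
  · exact absurd (Fin.ext (ha.trans hb.symm)) huv
  · right; nlinarith [Nat.mul_le_mul_left L (Nat.succ_le_of_lt hab)]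

/-- The vertex of `grid n L` at or before `v`. -/
def gridFloor (L : ℕ) (v : Fin (n + 1)) : Fin (n + 1) :=
  ⟨L * (v / L), (Nat.mul_div_le _ _).trans_lt v.isLt⟩

lemma gridFloor_mem_grid (L : ℕ) (v : Fin (n + 1)) : gridFloor L v ∈ grid n L :=
  mem_grid.2 ⟨_, rfl⟩

lemma mem_burning_add_of_gridFloor_mem_burning (hL : 0 < L) {x : ℕ → Fin (n + 1)} {t : ℕ}
    (h : gridFloor L v ∈ burning (pathGraph (n + 1)) x t) :
    v ∈ burning (pathGraph (n + 1)) x (t + L) := by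
  refine iterate_spread_burning_subset _ _ _ _
    (spread_mono.iterate L (Set.singleton_subset_iff.2 h) ?_)
  have hdiv := Nat.div_add_mod v.val L
  have hmod := Nat.mod_lt v.val hL
  refine mem_iterate_spread_pathGraph_singleton.2 ⟨?_, ?_⟩ <;> dsimp only [gridFloor] <;> omega

lemma gridFloor_preimage_ncard_le (hL : 0 < L) (u : Fin (n + 1)) :
    {v | gridFloor L v = u}.ncard ≤ L := by
  have h : (Fin.val '' {v : Fin (n + 1) | gridFloor L v = u}) ⊆ Finset.Ico u.val (u + L) := by
    rintro _ ⟨v, rfl, rfl⟩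
    have hdiv := Nat.div_add_mod v.val L
    have hmod := Nat.mod_lt v.val hL
    simp only [gridFloor, Finset.coe_Ico, Set.mem_Ico]
    omega
  have h' := Set.ncard_le_ncard h
  rwa [Set.ncard_image_of_injective _ Fin.val_injective, Set.ncard_coe_finset, Nat.card_Ico,
    Nat.add_sub_cancel_left] at h'

end Path

section BurningNumber

variable {n : ℕ}

lemma le_sq_of_burning_pathGraph_eq_univ {x : ℕ → Fin (n + 1)} {t : ℕ}
    (h : burning (pathGraph (n + 1)) x t = Set.univ) : n + 1 ≤ t ^ 2 := by
  have hcov : (⋃ i ∈ Finset.range t, (spread (pathGraph (n + 1)))^[t - 1 - i] {x i}) =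
      Set.univ := by
    simpa only [burning_eq_biUnion, Finset.mem_range] using h
  calc n + 1 = (Set.univ : Set (Fin (n + 1))).ncard := by simp
    _ ≤ ∑ i ∈ Finset.range t, ((spread (pathGraph (n + 1)))^[t - 1 - i] {x i}).ncard :=
        hcov ▸ Finset.set_ncard_biUnion_le _ _
    _ ≤ ∑ i ∈ Finset.range t, (2 * (t - 1 - i) + 1) :=
        Finset.sum_le_sum fun i _ => ncard_iterate_spread_pathGraph_singleton_le _ _
    _ = t ^ 2 := by
        rw [Finset.sum_range_reflect (fun i => 2 * i + 1), sum_range_two_mul_add_one]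

lemma sqrt_le_burningTime_pathGraph (x : ℕ → Fin (n + 1)) :
    √((n + 1 : ℕ) : ℝ) ≤ burningTime (pathGraph (n + 1)) x :=
  Real.sqrt_le_iff.2 ⟨Nat.cast_nonneg _, by
    exact_mod_cast le_sq_of_burning_pathGraph_eq_univ
      ((burningTime_le_iff (pathGraph_preconnected _)).1 le_rfl)⟩

-- Started in position `r ^ 2 + r` with `r` rounds left, the fire reaches `r ^ 2, …, r ^ 2 + 2 * r`.
lemma exists_burning_pathGraph_eq_univ {k : ℕ} (h : n + 1 ≤ k ^ 2) :
    ∃ y, burning (pathGraph (n + 1)) y k = Set.univ := by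
  let center : ℕ → Fin (n + 1) := fun r => ⟨min (r ^ 2 + r) n, by omega⟩
  refine ⟨fun i => center (k - 1 - i), Set.eq_univ_of_forall fun v => ?_⟩
  have hv₁ : Nat.sqrt v ^ 2 ≤ v := Nat.sqrt_le' _
  have hv₂ : v < (Nat.sqrt v + 1) ^ 2 := Nat.lt_succ_sqrt' _
  have hk : Nat.sqrt v < k := (Nat.pow_lt_pow_iff_left two_ne_zero).1 (by omega)
  have hi : k - 1 - (k - 1 - Nat.sqrt v) = Nat.sqrt v := by omega
  simp only [burning_eq_biUnion, Set.mem_iUnion]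
  refine ⟨k - 1 - Nat.sqrt v, by omega, ?_⟩
  rw [hi, mem_iterate_spread_pathGraph_singleton]
  simp only [center]
  grind

lemma sqrt_le_burningNumber_pathGraph (s : Timing) (n : ℕ) :
    √((n + 1 : ℕ) : ℝ) ≤ burningNumber s (pathGraph (n + 1)) := by
  obtain ⟨x, -, hx⟩ :=
    exists_isLegal_burning_burningNumber_eq_univ s (pathGraph_preconnected (n + 1))
  exact (sqrt_le_burningTime_pathGraph x).trans
    (Nat.cast_le.2 ((burningTime_le_iff (pathGraph_preconnected _)).2 hx))

lemma burningNumber_pathGraph_le (s : Timing) (n : ℕ) :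
    (burningNumber s (pathGraph (n + 1)) : ℝ) ≤ √((n + 1 : ℕ) : ℝ) + 1 := by
  have h : n + 1 ≤ ⌈√((n + 1 : ℕ) : ℝ)⌉₊ ^ 2 := by
    exact_mod_cast (Real.sqrt_le_left (Nat.cast_nonneg _)).1 (Nat.le_ceil (√((n + 1 : ℕ) : ℝ)))
  obtain ⟨y, hy⟩ := exists_burning_pathGraph_eq_univ h
  exact (Nat.cast_le.2 (burningNumber_le_of_burning_eq_univ s hy)).trans
    (Nat.ceil_lt_add_one (Real.sqrt_nonneg _)).le

end BurningNumber

section QuadraticGrowth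

variable {V : Type*} {G : SimpleGraph V} {pool : (ℕ → V) → ℕ → Set V} {E : Set (ℕ → V)}
  [Finite V] [Nonempty V] [MeasurableSpace V] [MeasurableSingletonClass V]

lemma IsAdmissible.processLaw_real_inter_disjoint_burning_le_exp (hp : IsAdmissible G pool)
    {s U k : ℕ} {S : Set V} {c : ℝ} (hE : DependsOn (· ∈ E) (Set.Iio s))
    (hU : ∀ x ∈ E, ∀ t, s ≤ t → (pool x t).ncard ≤ U)
    (hc : ∀ j < k, c * (2 * j + 1) ≤ ((spread G)^[j] S).ncard) :
    (processLaw pool).real (E ∩ {x | Disjoint S (burning G x (s + k))}) ≤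
      Real.exp (-(c * k ^ 2 / U)) *
        (processLaw pool).real (E ∩ {x | Disjoint ((spread G)^[k] S) (burning G x s)}) := by
  refine (hp.processLaw_real_inter_disjoint_burning_le hE hU k S).trans ?_
  have hsum : c * k ^ 2 ≤ ∑ j ∈ Finset.range k, (((spread G)^[j] S).ncard : ℝ) := by
    have hsq : ((k ^ 2 : ℕ) : ℝ) = ∑ j ∈ Finset.range k, (2 * (j : ℝ) + 1) := by
      exact_mod_cast (sum_range_two_mul_add_one k).symm
    rw [Nat.cast_pow] at hsq
    rw [hsq, Finset.mul_sum]
    exact Finset.sum_le_sum fun j hj => hc j (Finset.mem_range.1 hj)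
  rw [neg_div]
  gcongr

lemma IsAdmissible.processLaw_real_disjoint_burning_le_exp (hp : IsAdmissible G pool) {S : Set V}
    {T : ℕ} {c : ℝ} (hc : ∀ j < T, c * (2 * j + 1) ≤ ((spread G)^[j] S).ncard) :
    (processLaw pool).real {x | Disjoint S (burning G x T)} ≤
      Real.exp (-(c * T ^ 2 / Nat.card V)) := by
  have h := hp.processLaw_real_inter_disjoint_burning_le_exp (E := Set.univ) (s := 0)
    (fun _ _ _ => rfl) (fun x _ t _ => Set.ncard_le_card (pool x t)) hc
  rw [Set.univ_inter, zero_add] at h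
  exact h.trans (mul_le_of_le_one_right (Real.exp_pos _).le measureReal_le_one)

end QuadraticGrowth

section PathSurvival

variable {n T : ℕ} {pool : (ℕ → Fin (n + 1)) → ℕ → Set (Fin (n + 1))}

lemma IsAdmissible.processLaw_real_notMem_burning_pathGraph_le
    (hp : IsAdmissible (pathGraph (n + 1)) pool) (hT : T ≤ n + 1) (v : Fin (n + 1)) :
    (processLaw pool).real {x | v ∉ burning (pathGraph (n + 1)) x T} ≤
      Real.exp (-(T ^ 2 / (2 * (n + 1 : ℕ)))) := by
  have h := hp.processLaw_real_disjoint_burning_le_exp (S := {v}) (T := T) (c := 1 / 2)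
    fun j hj => ?_
  · simp only [Set.disjoint_singleton_left, Nat.card_fin] at h
    refine h.trans_eq ?_
    congr 2
    ring
  · have : (j + 1 : ℝ) ≤ ((spread (pathGraph (n + 1)))^[j] {v}).ncard := by
      exact_mod_cast succ_le_ncard_iterate_spread_pathGraph_singleton (by omega) v
    linarith

lemma IsAdmissible.processLaw_real_notMem_burning_pathGraph_le_of_interior
    (hp : IsAdmissible (pathGraph (n + 1)) pool) {v : Fin (n + 1)} (h₁ : T ≤ v.val + 1)
    (h₂ : v + T ≤ n + 1) :
    (processLaw pool).real {x | v ∉ burning (pathGraph (n + 1)) x T} ≤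
      Real.exp (-(T ^ 2 / (n + 1 : ℕ))) := by
  have h := hp.processLaw_real_disjoint_burning_le_exp (S := {v}) (T := T) (c := 1)
    fun j hj => ?_
  · simpa only [Set.disjoint_singleton_left, Nat.card_fin, one_mul] using h
  · rw [ncard_iterate_spread_pathGraph_singleton_of_interior (by omega) (by omega)]
    push_cast
    linarith

lemma IsAdmissible.processLaw_real_notMem_burning_pathGraph_pair_le
    (hp : IsAdmissible (pathGraph (n + 1)) pool) {u v : Fin (n + 1)}
    (hu₁ : T ≤ u.val + 1) (hu₂ : u + T ≤ n + 1) (hv₁ : T ≤ v.val + 1) (hv₂ : v + T ≤ n + 1)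
    (huv : u + 2 * T ≤ v.val ∨ v + 2 * T ≤ u.val) (hne : u ≠ v) :
    (processLaw pool).real ({x | u ∉ burning (pathGraph (n + 1)) x T} ∩
      {x | v ∉ burning (pathGraph (n + 1)) x T}) ≤ Real.exp (-(2 * T ^ 2 / (n + 1 : ℕ))) := by
  have h := hp.processLaw_real_disjoint_burning_le_exp (S := ({u, v} : Finset (Fin (n + 1))))
    (T := T) (c := 2) fun j hj => ?_
  · rw [Nat.card_fin] at h
    refine (measureReal_mono fun x hx => ?_).trans h
    simpa only [Finset.coe_pair, Set.mem_inter_iff, Set.mem_ofPred_eq,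
      Set.disjoint_insert_left, Set.disjoint_singleton_left] using hx
  · have hdisj : (({u, v} : Finset (Fin (n + 1))) : Set (Fin (n + 1))).PairwiseDisjoint fun w =>
        (spread (pathGraph (n + 1)))^[j] {w} := by
      rw [Finset.coe_pair, Set.pairwiseDisjoint_insert]
      refine ⟨Set.pairwiseDisjoint_singleton _ _, fun w hw _ => ?_⟩
      obtain rfl := hw
      exact disjoint_iterate_spread_pathGraph_singleton (by omega)
    rw [ncard_iterate_spread_of_pairwiseDisjoint hdisj, Finset.sum_pair hne,
      ncard_iterate_spread_pathGraph_singleton_of_interior (by omega) (by omega),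
      ncard_iterate_spread_pathGraph_singleton_of_interior (by omega) (by omega)]
    push_cast
    linarith

lemma exp_neg_div_sub_le_one_sub_div {a b : ℝ} (h : a < b) (hb : 0 < b) :
    Real.exp (-(a / (b - a))) ≤ 1 - a / b := by
  have hba : 0 < b - a := sub_pos.2 h
  have hexp : b / (b - a) ≤ Real.exp (a / (b - a)) := by
    refine le_trans (le_of_eq ?_) (Real.add_one_le_exp _)
    field_simp
    ring
  rw [Real.exp_neg, one_sub_div hb.ne', ← inv_div b]
  exact inv_anti₀ (by positivity) hexp

lemma IsAdmissible.exp_le_processLaw_real_notMem_burning_pathGraph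
    (hp : IsAdmissible (pathGraph (n + 1)) pool) (hcard : ∀ x t, n + 1 ≤ (pool x t).ncard + t)
    (hT : 3 * T < n + 1) (v : Fin (n + 1)) :
    Real.exp (-(T ^ 2 / ((n + 1 : ℕ) - 3 * T))) ≤
      (processLaw pool).real {x | v ∉ burning (pathGraph (n + 1)) x T} := by
  have hball := ncard_iterate_spread_pathGraph_singleton_le (v := v)
  have h := hp.le_processLaw_real_disjoint_burning (u := n + 1 - T) (T := T) (S := {v})
    (fun x t ht => by have := hcard x t; omega) (fun j hj => by have := hball j; omega)
  simp only [Set.disjoint_singleton_left] at h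
  refine le_trans ?_ h
  have hTn : 3 * (T : ℝ) < (n + 1 : ℕ) := by exact_mod_cast hT
  have hsq : (T : ℝ) ^ 2 = ∑ j ∈ Finset.range T, (2 * (j : ℝ) + 1) := by
    exact_mod_cast (sum_range_two_mul_add_one T).symm
  rw [hsq, Finset.sum_div, ← Finset.sum_neg_distrib, Real.exp_sum, Nat.cast_sub (by omega)]
  refine Finset.prod_le_prod (fun _ _ => (Real.exp_pos _).le) fun j hj => ?_
  have hj' : (j : ℝ) + 1 ≤ T := by exact_mod_cast Finset.mem_range.1 hj
  have hb : (((spread (pathGraph (n + 1)))^[j] {v}).ncard : ℝ) ≤ 2 * j + 1 := by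
    exact_mod_cast hball j
  calc Real.exp (-((2 * j + 1) / ((n + 1 : ℕ) - 3 * T)))
      ≤ Real.exp (-((2 * j + 1) / ((n + 1 : ℕ) - T - (2 * j + 1)))) :=
        Real.exp_le_exp.2 (neg_le_neg (div_le_div_of_nonneg_left (by positivity)
          (by linarith) (by linarith)))
    _ ≤ 1 - (2 * j + 1) / ((n + 1 : ℕ) - T) :=
        exp_neg_div_sub_le_one_sub_div (by linarith) (by linarith)
    _ ≤ _ := sub_le_sub_left (div_le_div_of_nonneg_right hb (by linarith)) 1

lemma card_le_ncard_pool₁_add {V : Type*} (x : ℕ → V) (t : ℕ) :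
    Nat.card V ≤ (pool₁ x t).ncard + t := by
  simp [pool₁, Set.ncard_univ]

lemma card_le_ncard_pool₂_add {V : Type*} [Finite V] (x : ℕ → V) (t : ℕ) :
    Nat.card V ≤ (pool₂ x t).ncard + t := by
  have hcompl : (pool₂ x t)ᶜ = x '' (Finset.range t) := by
    ext v
    simp [pool₂]
  have himage : (x '' (Finset.range t)).ncard ≤ t := by
    simpa only [Set.ncard_coe_finset, Finset.card_range] using
      Set.ncard_image_le (f := x) (Finset.range t).finite_toSet
  rw [← Set.ncard_add_ncard_compl (pool₂ x t), hcompl]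
  omega

end PathSurvival

section FirstMoment

variable {n T L J : ℕ}

lemma card_filter_grid_le (hTJ : T ≤ J * L) :
    ((grid n L).filter fun v => ¬(T ≤ v.val + 1 ∧ v.val + T ≤ n + 1)).card ≤ 2 * J := by
  calc _ ≤ (Finset.range J ∪ Finset.Ioc (n / L - J) (n / L)).card := by
        refine Finset.card_le_card_of_injOn (fun v => v.val / L) (fun v hv => ?_)
          fun u hu v hv huv => ?_
        · obtain ⟨hvL, hvT⟩ := Finset.mem_filter.1 hv
          obtain ⟨a, ha⟩ := mem_grid.1 hvL
          have hL : 0 < L := by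
            by_contra! h
            obtain rfl : L = 0 := by omega
            simp only [mul_zero, nonpos_iff_eq_zero] at hTJ
            omega
          have haL : a ≤ n / L := (Nat.le_div_iff_mul_le hL).2 (by rw [mul_comm]; omega)
          simp only [ha, Nat.mul_div_cancel_left a hL, Finset.coe_union, Finset.coe_range,
            Finset.coe_Ioc, Set.mem_union, Set.mem_Iio, Set.mem_Ioc]
          by_cases haJ : a < J
          · exact Or.inl haJ
          · have hle : T ≤ L * a := hTJ.trans (by nlinarith)
            have hlt : n < L * a + T := by omega
            have : n / L < a + J := (Nat.div_lt_iff_lt_mul hL).2 (by linarith)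
            omega
        · exact Fin.ext ((Nat.div_left_inj (mem_grid.1 (Finset.mem_filter.1 hu).1)
            (mem_grid.1 (Finset.mem_filter.1 hv).1)).1 huv)
    _ ≤ J + J := by
        refine (Finset.card_union_le _ _).trans ?_
        rw [Finset.card_range, Nat.card_Ioc]
        omega
    _ = 2 * J := (two_mul J).symm

lemma IsAdmissible.processLaw_real_burning_pathGraph_ne_univ_le
    {pool : (ℕ → Fin (n + 1)) → ℕ → Set (Fin (n + 1))}
    (hp : IsAdmissible (pathGraph (n + 1)) pool) (hT : T ≤ n + 1) (hL : 0 < L)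
    (hTJ : T ≤ J * L) :
    (processLaw pool).real {x | burning (pathGraph (n + 1)) x (T + L) ≠ Set.univ} ≤
      2 * J * Real.exp (-(T ^ 2 / (2 * (n + 1 : ℕ)))) +
        (n / L + 1 : ℕ) * Real.exp (-(T ^ 2 / (n + 1 : ℕ))) := by
  set f : Fin (n + 1) → ℝ := fun v =>
    (processLaw pool).real {x | v ∉ burning (pathGraph (n + 1)) x T}
  have hsub : {x | burning (pathGraph (n + 1)) x (T + L) ≠ Set.univ} ⊆
      ⋃ v ∈ grid n L, {x | v ∉ burning (pathGraph (n + 1)) x T} := by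
    intro x hx
    obtain ⟨v, hv⟩ := (Set.ne_univ_iff_exists_notMem _).1 hx
    exact Set.mem_biUnion (gridFloor_mem_grid L v)
      fun h => hv (mem_burning_add_of_gridFloor_mem_burning hL h)
  have hboundary : ∑ v ∈ grid n L with ¬(T ≤ v.val + 1 ∧ v.val + T ≤ n + 1), f v ≤
      2 * J * Real.exp (-(T ^ 2 / (2 * (n + 1 : ℕ)))) := by
    refine (Finset.sum_le_card_nsmul _ _ _ fun v _ =>
      hp.processLaw_real_notMem_burning_pathGraph_le hT v).trans ?_
    rw [nsmul_eq_mul]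
    gcongr
    exact_mod_cast card_filter_grid_le hTJ
  have hinterior : ∑ v ∈ grid n L with T ≤ v.val + 1 ∧ v.val + T ≤ n + 1, f v ≤
      (n / L + 1 : ℕ) * Real.exp (-(T ^ 2 / (n + 1 : ℕ))) := by
    refine (Finset.sum_le_card_nsmul _ _ (Real.exp (-(T ^ 2 / (n + 1 : ℕ))))
      fun v hv => ?_).trans ?_
    · obtain ⟨-, h₁, h₂⟩ := Finset.mem_filter.1 hv
      exact hp.processLaw_real_notMem_burning_pathGraph_le_of_interior h₁ h₂
    · rw [nsmul_eq_mul]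
      gcongr
      exact (Finset.card_filter_le _ _).trans (card_grid_le n L)
  calc _ ≤ ∑ v ∈ grid n L, f v :=
        (measureReal_mono hsub (measure_ne_top _ _)).trans (measureReal_biUnion_finset_le _ _)
    _ = _ + _ := (Finset.sum_filter_not_add_sum_filter _ _ _).symm
    _ ≤ _ := add_le_add hboundary hinterior

end FirstMoment

section SecondMoment

variable {Ω ι : Type*} [MeasurableSpace Ω] [Fintype ι] {P : Measure Ω} {A : ι → Set Ω}

lemma integral_sum_indicator_one {ι : Type*} {A : ι → Set Ω} [IsFiniteMeasure P] (s : Finset ι)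
    (hA : ∀ i, MeasurableSet (A i)) :
    ∫ ω, ∑ i ∈ s, (A i).indicator (1 : Ω → ℝ) ω ∂P = ∑ i ∈ s, P.real (A i) := by
  rw [integral_finsetSum _ fun i _ => (integrable_const 1).indicator (hA i)]
  exact Finset.sum_congr rfl fun i _ => integral_indicator_one (hA i)

lemma integral_sq_sum_indicator_one [IsFiniteMeasure P] (hA : ∀ i, MeasurableSet (A i)) :
    ∫ ω, (∑ i, (A i).indicator (1 : Ω → ℝ) ω) ^ 2 ∂P = ∑ i, ∑ j, P.real (A i ∩ A j) := by
  have hprod : ∀ ω, (∑ i, (A i).indicator (1 : Ω → ℝ) ω) ^ 2 =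
      ∑ p : ι × ι, (A p.1 ∩ A p.2).indicator (1 : Ω → ℝ) ω := fun ω => by
    simp only [sq, Finset.sum_mul_sum, ← Finset.univ_product_univ, Finset.sum_product,
      Set.inter_indicator_one, Pi.mul_apply]
  simp only [hprod, integral_sum_indicator_one _ fun p : ι × ι => (hA p.1).inter (hA p.2)]
  exact Fintype.sum_prod_type _

variable [IsProbabilityMeasure P]

lemma measureReal_iInter_compl_le (hA : ∀ i, MeasurableSet (A i))
    (hpos : 0 < ∑ i, P.real (A i)) :
    P.real (⋂ i, (A i)ᶜ) ≤
      (∑ i, ∑ j, P.real (A i ∩ A j)) / (∑ i, P.real (A i)) ^ 2 - 1 := by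
  set Y : Ω → ℝ := fun ω => ∑ i, (A i).indicator (1 : Ω → ℝ) ω
  have hmean : P[Y] = ∑ i, P.real (A i) := integral_sum_indicator_one _ hA
  have hmem : MemLp Y 2 P :=
    memLp_finsetSum _ fun i _ => (memLp_const (1 : ℝ)).indicator (hA i)
  have hsub : (⋂ i, (A i)ᶜ) ⊆ {ω | ∑ i, P.real (A i) ≤ |Y ω - P[Y]|} := by
    intro ω hω
    have hY : Y ω = 0 := Finset.sum_eq_zero fun i _ =>
      Set.indicator_of_notMem (Set.mem_iInter.1 hω i) _
    simp only [Set.mem_ofPred_eq, hY, hmean, zero_sub, abs_neg]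
    exact le_abs_self _
  calc P.real (⋂ i, (A i)ᶜ)
      ≤ (ENNReal.ofReal (Var[Y; P] / (∑ i, P.real (A i)) ^ 2)).toReal :=
        ENNReal.toReal_mono ENNReal.ofReal_ne_top
          ((measure_mono hsub).trans (meas_ge_le_variance_div_sq hmem hpos))
    _ = Var[Y; P] / (∑ i, P.real (A i)) ^ 2 :=
        ENNReal.toReal_ofReal (div_nonneg (variance_nonneg _ _) (sq_nonneg _))
    _ = _ := by
        rw [variance_eq_sub hmem, hmean, sub_div, div_self (pow_pos hpos 2).ne']
        congr 2
        exact integral_sq_sum_indicator_one hA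

lemma measureReal_iInter_compl_le_of_forall [Nonempty ι] {p₁ p₂ : ℝ}
    (hA : ∀ i, MeasurableSet (A i)) (hp₁ : 0 < p₁) (h₁ : ∀ i, p₁ ≤ P.real (A i))
    (h₂ : Pairwise fun i j => P.real (A i ∩ A j) ≤ p₂) (hp₂ : 0 ≤ p₂) :
    P.real (⋂ i, (A i)ᶜ) ≤ 1 / (Fintype.card ι * p₁) + p₂ / p₁ ^ 2 - 1 := by
  classical
  have hm : (0 : ℝ) < Fintype.card ι := by exact_mod_cast Fintype.card_pos
  set M := ∑ i, P.real (A i)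
  have hM : Fintype.card ι * p₁ ≤ M := by
    simpa only [Finset.card_univ, nsmul_eq_mul] using
      Finset.card_nsmul_le_sum Finset.univ _ _ fun i _ => h₁ i
  have hMpos : 0 < M := (mul_pos hm hp₁).trans_le hM
  have hrow : ∀ i, ∑ j, P.real (A i ∩ A j) ≤ P.real (A i) + Fintype.card ι * p₂ := fun i => by
    rw [← Finset.add_sum_erase _ _ (Finset.mem_univ i), Set.inter_self]
    gcongr
    refine (Finset.sum_le_card_nsmul _ _ p₂ fun j hj =>
      h₂ (Finset.ne_of_mem_erase hj).symm).trans ?_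
    rw [nsmul_eq_mul]
    gcongr
    exact Finset.card_erase_le
  have hpairs : ∑ i, ∑ j, P.real (A i ∩ A j) ≤ M + (Fintype.card ι : ℝ) ^ 2 * p₂ := by
    refine (Finset.sum_le_sum fun i _ => hrow i).trans_eq ?_
    rw [Finset.sum_add_distrib, Finset.sum_const, Finset.card_univ, nsmul_eq_mul]
    ring
  calc P.real (⋂ i, (A i)ᶜ)
      ≤ (M + (Fintype.card ι : ℝ) ^ 2 * p₂) / M ^ 2 - 1 :=
        (measureReal_iInter_compl_le hA hMpos).trans (by gcongr)
    _ = 1 / M + (Fintype.card ι : ℝ) ^ 2 * p₂ / M ^ 2 - 1 := by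
        field_simp
    _ ≤ 1 / (Fintype.card ι * p₁) +
          (Fintype.card ι : ℝ) ^ 2 * p₂ / (Fintype.card ι * p₁) ^ 2 - 1 := by
        gcongr
    _ = _ := by
        field_simp

end SecondMoment

lemma exp_neg_div_div_sq_exp_neg_div {T N : ℝ} (hT : 3 * T < N) (hN : 0 < N) :
    Real.exp (-(2 * T ^ 2 / N)) / Real.exp (-(T ^ 2 / (N - 3 * T))) ^ 2 =
      Real.exp (6 * T ^ 3 / (N * (N - 3 * T))) := by
  have hTN : N - T * 3 ≠ 0 := (sub_pos.2 (mul_comm 3 T ▸ hT)).ne'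
  rw [← Real.exp_nat_mul, ← Real.exp_sub]
  congr 1
  push_cast
  field_simp
  ring

section PathSecondMoment

variable {n T m : ℕ} {pool : (ℕ → Fin (n + 1)) → ℕ → Set (Fin (n + 1))}

lemma IsAdmissible.processLaw_real_burning_pathGraph_eq_univ_le
    (hp : IsAdmissible (pathGraph (n + 1)) pool) (hcard : ∀ x t, n + 1 ≤ (pool x t).ncard + t)
    (hT : 3 * T < n + 1) (hT₀ : 0 < T) (hm : 0 < m) (hmT : 2 * T * m ≤ n + 1) :
    (processLaw pool).real {x | burning (pathGraph (n + 1)) x T = Set.univ} ≤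
      Real.exp (T ^ 2 / ((n + 1 : ℕ) - 3 * T)) / m +
        Real.exp (6 * T ^ 3 / ((n + 1 : ℕ) * ((n + 1 : ℕ) - 3 * T))) - 1 := by
  have : NeZero m := ⟨hm.ne'⟩
  have hblock : ∀ i : Fin m, 2 * T * i + 2 * T ≤ n + 1 := fun i => by
    nlinarith [i.isLt]
  set v : Fin m → Fin (n + 1) := fun i => ⟨2 * T * i + T, by have := hblock i; omega⟩ with hv
  have hsep : ∀ i j : Fin m, i < j → v i + 2 * T ≤ (v j).val := fun i j hij => by
    have : (i : ℕ) + 1 ≤ j := hij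
    simp only [hv]
    nlinarith
  set A : Fin m → Set (ℕ → Fin (n + 1)) := fun i => {x | v i ∉ burning (pathGraph (n + 1)) x T}
  have hN : (0 : ℝ) < (n + 1 : ℕ) - 3 * T := sub_pos.2 (by exact_mod_cast hT)
  have hA : ∀ i, MeasurableSet (A i) := fun i => measurableSet_of_dependsOn (t := T)
    fun x y hxy => by
      simp only [A, Set.mem_ofPred_eq, dependsOn_burning (pathGraph (n + 1)) T hxy]
  have hsingle : ∀ i, Real.exp (-(T ^ 2 / ((n + 1 : ℕ) - 3 * T))) ≤
      (processLaw pool).real (A i) := fun i =>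
    hp.exp_le_processLaw_real_notMem_burning_pathGraph hcard hT (v i)
  have hpair : Pairwise fun i j =>
      (processLaw pool).real (A i ∩ A j) ≤ Real.exp (-(2 * T ^ 2 / (n + 1 : ℕ))) := by
    intro i j hij
    have hi := hblock i
    have hj := hblock j
    have hsep' : v i + 2 * T ≤ (v j).val ∨ v j + 2 * T ≤ (v i).val :=
      hij.lt_or_gt.imp (hsep i j) (hsep j i)
    exact hp.processLaw_real_notMem_burning_pathGraph_pair_le (by grind) (by grind) (by grind)
      (by grind) hsep' (by grind)
  have hsub : {x | burning (pathGraph (n + 1)) x T = Set.univ} ⊆ ⋂ i, (A i)ᶜ :=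
    fun x hx => Set.mem_iInter.2 fun i hi => hi (hx ▸ Set.mem_univ (v i) :)
  refine (measureReal_mono hsub).trans ((measureReal_iInter_compl_le_of_forall hA
    (Real.exp_pos _) hsingle hpair (Real.exp_pos _).le).trans_eq ?_)
  rw [exp_neg_div_div_sq_exp_neg_div (sub_pos.1 hN) (Nat.cast_pos.2 n.succ_pos),
    Fintype.card_fin, Real.exp_neg, one_div, mul_inv_rev, inv_inv, ← div_eq_mul_inv]

end PathSecondMoment

lemma sum_measureReal_le_of_card_filter_le {Ω ι : Type*} [MeasurableSpace Ω] {P : Measure Ω}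
    [IsProbabilityMeasure P] {s : Finset ι} {A : ι → Set Ω} (hA : ∀ i, MeasurableSet (A i))
    {K : ℕ} (h : ∀ ω, {i | i ∈ s ∧ ω ∈ A i}.ncard ≤ K) : ∑ i ∈ s, P.real (A i) ≤ K := by
  classical
  have hcard : ∀ ω, ∑ i ∈ s, (A i).indicator (1 : Ω → ℝ) ω ≤ K := fun ω => by
    have hω := h ω
    rw [← Finset.coe_filter, Set.ncard_coe_finset] at hω
    simp only [Set.indicator_apply, Pi.one_apply, Finset.sum_boole]
    exact_mod_cast hω
  calc ∑ i ∈ s, P.real (A i) = ∫ ω, ∑ i ∈ s, (A i).indicator (1 : Ω → ℝ) ω ∂P :=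
        (integral_sum_indicator_one s hA).symm
    _ ≤ ∫ _, (K : ℝ) ∂P := integral_mono (integrable_finsetSum _ fun i _ =>
        (integrable_const 1).indicator (hA i)) (integrable_const _) hcard
    _ = K := by simp

/-- The number of vertices that are not burning at the end of round `t`. -/
noncomputable def unburntCount {V : Type*} (G : SimpleGraph V) (x : ℕ → V) (t : ℕ) : ℕ :=
  (burning G x t)ᶜ.ncard

lemma dependsOn_unburntCount_le {V : Type*} (G : SimpleGraph V) (t M : ℕ) :
    DependsOn (· ∈ {x | unburntCount G x t ≤ M}) (Set.Iio t) :=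
  fun _ _ h => congrArg (fun B : Set V => Bᶜ.ncard ≤ M) (dependsOn_burning G t h)

lemma ncard_pool₃_le {V : Type*} [Finite V] (s : Timing) (G : SimpleGraph V) (x : ℕ → V)
    {t₀ t : ℕ} (h : t₀ ≤ t) : (pool₃ s G x t).ncard ≤ unburntCount G x t₀ :=
  Set.ncard_le_ncard
    ((unburnt_subset s G x t).trans (Set.compl_subset_compl.2 (burning_mono G x h)))

section Phases

variable {n r m M β t t₀ τ : ℕ} {x : ℕ → Fin (n + 1)} {S : Finset (Fin (n + 1))}

lemma exists_subset_grid_disjoint_burning {L : ℕ} (hL : 0 < L)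
    (h : L * m < unburntCount (pathGraph (n + 1)) x (t + L)) :
    ∃ S ∈ (grid n L).powersetCard m, Disjoint (S : Set (Fin (n + 1)))
      (burning (pathGraph (n + 1)) x t) := by
  classical
  set g := (grid n L).filter (· ∉ burning (pathGraph (n + 1)) x t)
  have hcover : (burning (pathGraph (n + 1)) x (t + L))ᶜ ⊆ ⋃ u ∈ g, {v | gridFloor L v = u} :=
    fun v hv => Set.mem_biUnion (Finset.mem_filter.2 ⟨gridFloor_mem_grid L v,
      fun h => hv (mem_burning_add_of_gridFloor_mem_burning hL h)⟩) rfl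
  have hcard : L * m < L * g.card :=
    calc L * m < (burning (pathGraph (n + 1)) x (t + L))ᶜ.ncard := h
      _ ≤ ∑ u ∈ g, {v | gridFloor L v = u}.ncard :=
        (Set.ncard_le_ncard hcover).trans (Finset.set_ncard_biUnion_le _ _)
      _ ≤ g.card • L := Finset.sum_le_card_nsmul _ _ _ fun u _ => gridFloor_preimage_ncard_le hL u
      _ = L * g.card := mul_comm _ _
  obtain ⟨S, hSg, hS⟩ := Finset.exists_subset_card_eq (Nat.lt_of_mul_lt_mul_left hcard).le
  exact ⟨S, Finset.mem_powersetCard.2 ⟨hSg.trans (Finset.filter_subset _ _), hS⟩,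
    Set.disjoint_left.2 fun v hv => (Finset.mem_filter.1 (hSg hv)).2⟩

lemma card_mul_succ_le_ncard_iterate_spread {L k : ℕ} (hS : S ⊆ grid n L) (hkL : 2 * k < L)
    (hk : k ≤ n) : S.card * (k + 1) ≤ ((spread (pathGraph (n + 1)))^[k] S).ncard := by
  rw [ncard_iterate_spread_of_pairwiseDisjoint
    ((pairwiseDisjoint_grid hkL).subset (Finset.coe_subset.2 hS))]
  exact Finset.card_nsmul_le_sum _ _ _ fun v _ =>
    succ_le_ncard_iterate_spread_pathGraph_singleton hk v

lemma ncard_disjoint_iterate_spread_burning_le (hr : r ≤ n)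
    (h : unburntCount (pathGraph (n + 1)) x t ≤ M) :
    {S | S ⊆ grid n (2 * r + 1) ∧ Disjoint ((spread (pathGraph (n + 1)))^[r] (S : Set _))
      (burning (pathGraph (n + 1)) x t)}.ncard ≤ 2 ^ (M / (r + 1)) := by
  classical
  set g := (grid n (2 * r + 1)).filter fun v =>
    Disjoint ((spread (pathGraph (n + 1)))^[r] {v}) (burning (pathGraph (n + 1)) x t)
  have hg : g.card ≤ M / (r + 1) := by
    refine (Nat.le_div_iff_mul_le r.succ_pos).2 (le_trans ?_ h)
    refine (card_mul_succ_le_ncard_iterate_spread (Finset.filter_subset _ _)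
      (2 * r).lt_succ_self hr).trans (Set.ncard_le_ncard (Disjoint.subset_compl_right ?_))
    rw [iterate_spread_biUnion, Set.disjoint_iUnion₂_left]
    exact fun v hv => (Finset.mem_filter.1 hv).2
  refine le_trans ?_ (Nat.pow_le_pow_right two_pos hg)
  rw [← Finset.card_powerset, ← Set.ncard_coe_finset]
  refine Set.ncard_le_ncard (fun S hS => ?_)
  obtain ⟨hSgrid, hSx⟩ := hS
  rw [iterate_spread_biUnion, Set.disjoint_iUnion₂_left] at hSx
  exact Finset.mem_coe.2 (Finset.mem_powerset.2 fun v hv =>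
    Finset.mem_filter.2 ⟨hSgrid hv, hSx v hv⟩)

lemma sum_measureReal_disjoint_iterate_spread_burning_le (P : Measure (ℕ → Fin (n + 1)))
    [IsProbabilityMeasure P] (hr : r ≤ n) (t m M : ℕ) :
    ∑ S ∈ (grid n (2 * r + 1)).powersetCard m,
      P.real ({x | unburntCount (pathGraph (n + 1)) x t ≤ M} ∩
        {x | Disjoint ((spread (pathGraph (n + 1)))^[r] (S : Set (Fin (n + 1))))
          (burning (pathGraph (n + 1)) x t)}) ≤ 2 ^ (M / (r + 1)) := by
  have hbound := sum_measureReal_le_of_card_filter_le (P := P) (K := 2 ^ (M / (r + 1)))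
    (s := (grid n (2 * r + 1)).powersetCard m) (fun S => measurableSet_of_dependsOn
      (dependsOn_mem_inter (dependsOn_unburntCount_le (pathGraph (n + 1)) t M)
        (dependsOn_disjoint_burning (pathGraph (n + 1))
          ((spread (pathGraph (n + 1)))^[r] S) t))) fun x => ?_
  · exact_mod_cast hbound
  by_cases hx : unburntCount (pathGraph (n + 1)) x t ≤ M
  · refine (Set.ncard_le_ncard fun S hS => ?_).trans
      (ncard_disjoint_iterate_spread_burning_le hr hx)
    exact ⟨(Finset.mem_powersetCard.1 hS.1).1, hS.2.2⟩
  · simp [hx]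

lemma processLaw_real_pool₃_unburntCount_le (s : Timing) (hr : r ≤ n) (t₀ m M : ℕ) :
    (processLaw (pool₃ s (pathGraph (n + 1)))).real
      {x | unburntCount (pathGraph (n + 1)) x t₀ ≤ M ∧
        (2 * r + 1) * m < unburntCount (pathGraph (n + 1)) x (t₀ + r + (2 * r + 1))} ≤
      Real.exp (-(m / 2 * r ^ 2 / M)) * 2 ^ (M / (r + 1)) := by
  set G := pathGraph (n + 1)
  set μ := processLaw (pool₃ s G)
  set E := {x | unburntCount G x t₀ ≤ M}
  set 𝒮 := (grid n (2 * r + 1)).powersetCard m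
  set A : Finset (Fin (n + 1)) → Set (ℕ → Fin (n + 1)) := fun S =>
    E ∩ {x | Disjoint ((spread G)^[r] S) (burning G x t₀)}
  have hcover : {x | unburntCount G x t₀ ≤ M ∧
      (2 * r + 1) * m < unburntCount G x (t₀ + r + (2 * r + 1))} ⊆
      ⋃ S ∈ 𝒮, E ∩ {x | Disjoint (S : Set (Fin (n + 1))) (burning G x (t₀ + r))} := by
    rintro x ⟨hxE, hx⟩
    obtain ⟨S, hS, hSx⟩ := exists_subset_grid_disjoint_burning (Nat.succ_pos _) hx
    exact Set.mem_biUnion hS ⟨hxE, hSx⟩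
  have hsurvive : ∀ S ∈ 𝒮, μ.real (E ∩ {x | Disjoint (S : Set (Fin (n + 1)))
      (burning G x (t₀ + r))}) ≤ Real.exp (-(m / 2 * r ^ 2 / M)) * μ.real (A S) := by
    intro S hS
    obtain ⟨hSgrid, rfl⟩ := Finset.mem_powersetCard.1 hS
    refine (isAdmissible_pool₃ s G).processLaw_real_inter_disjoint_burning_le_exp
      (dependsOn_unburntCount_le G t₀ M) (fun x hx t ht => (ncard_pool₃_le s G x ht).trans hx)
      fun j hj => ?_
    have : (S.card * (j + 1) : ℝ) ≤ ((spread G)^[j] (S : Set (Fin (n + 1)))).ncard := by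
      exact_mod_cast card_mul_succ_le_ncard_iterate_spread hSgrid (by omega) (by omega)
    linarith [S.card.cast_nonneg (α := ℝ)]
  calc _ ≤ ∑ S ∈ 𝒮, Real.exp (-(m / 2 * r ^ 2 / M)) * μ.real (A S) :=
        (measureReal_mono hcover (measure_ne_top _ _)).trans
          ((measureReal_biUnion_finset_le _ _).trans (Finset.sum_le_sum hsurvive))
    _ ≤ _ := by
        rw [← Finset.mul_sum]
        gcongr
        exact sum_measureReal_disjoint_iterate_spread_burning_le μ hr t₀ m M

lemma two_pow_le_exp (k : ℕ) : (2 : ℝ) ^ k ≤ Real.exp k := by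
  rw [← mul_one (k : ℝ), Real.exp_nat_mul]
  gcongr
  linarith [Real.add_one_le_exp (1 : ℝ)]

lemma processLaw_real_pool₃_halving_le (s : Timing) (hτ : 41 ≤ τ) (hτn : 20 * τ ≤ n) (t₀ : ℕ) :
    (processLaw (pool₃ s (pathGraph (n + 1)))).real
      {x | unburntCount (pathGraph (n + 1)) x t₀ ≤ (2 * τ) ^ 2 ∧
        τ ^ 2 < unburntCount (pathGraph (n + 1)) x (t₀ + (60 * τ + 1))} ≤
      Real.exp (-(τ / 5)) := by
  set m := τ / 41
  have hm : τ ≤ 82 * m := by omega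
  have hmτ : (2 * (20 * τ) + 1) * m ≤ τ ^ 2 :=
    calc (2 * (20 * τ) + 1) * m ≤ 41 * τ * m := by gcongr; omega
      _ = τ * (41 * m) := by ring
      _ ≤ τ * τ := by gcongr; exact Nat.mul_div_le τ 41
      _ = τ ^ 2 := (sq τ).symm
  have hexponent : ((m : ℝ) / 2 * ((20 * τ : ℕ) : ℝ) ^ 2 / (((2 * τ) ^ 2 : ℕ) : ℝ)) = 50 * m := by
    have : (τ : ℝ) ≠ 0 := by exact_mod_cast (by omega : τ ≠ 0)
    push_cast
    field_simp
    ring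
  have hchoices : (((2 * τ) ^ 2 / (20 * τ + 1) : ℕ) : ℝ) ≤ τ / 5 := by
    refine Nat.cast_div_le.trans ((div_le_iff₀ (by positivity)).2 ?_)
    push_cast
    nlinarith [τ.cast_nonneg (α := ℝ)]
  have hround : t₀ + (60 * τ + 1) = t₀ + 20 * τ + (2 * (20 * τ) + 1) := by ring
  rw [hround]
  calc _ ≤ Real.exp (-(50 * m)) * 2 ^ ((2 * τ) ^ 2 / (20 * τ + 1)) := by
        rw [← hexponent]
        refine le_trans (measureReal_mono ?_)
          (processLaw_real_pool₃_unburntCount_le s hτn t₀ m ((2 * τ) ^ 2))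
        exact fun x hx => ⟨hx.1, hmτ.trans_lt hx.2⟩
    _ ≤ Real.exp (-(50 * m)) * Real.exp (τ / 5) := by
        gcongr
        exact (two_pow_le_exp _).trans (Real.exp_le_exp.2 hchoices)
    _ ≤ Real.exp (-(τ / 5)) := by
        rw [← Real.exp_add, Real.exp_le_exp]
        have : (τ : ℝ) ≤ 82 * m := by exact_mod_cast hm
        linarith

lemma processLaw_real_pool₃_iterate_halving_le (s : Timing) (hβ : 41 ≤ β) (K : ℕ)
    (hn : 20 * (β * 2 ^ K) ≤ n) (t₀ : ℕ) :
    (processLaw (pool₃ s (pathGraph (n + 1)))).real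
      {x | unburntCount (pathGraph (n + 1)) x t₀ ≤ (β * 2 ^ K) ^ 2 ∧
        β ^ 2 < unburntCount (pathGraph (n + 1)) x
          (t₀ + ∑ j ∈ Finset.range K, (60 * (β * 2 ^ j) + 1))} ≤
      K * Real.exp (-(β / 5)) := by
  induction K generalizing t₀ with
  | zero =>
    have hempty : ∀ x : ℕ → Fin (n + 1), ¬(unburntCount (pathGraph (n + 1)) x t₀ ≤ β ^ 2 ∧
        β ^ 2 < unburntCount (pathGraph (n + 1)) x t₀) := fun x hx => by omega
    simp [hempty]
  | succ K ih =>
    set τ := β * 2 ^ K with hτ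
    have hβτ : β ≤ τ := Nat.le_mul_of_pos_right _ (by positivity)
    have hpow : β * 2 ^ (K + 1) = 2 * τ := by rw [hτ]; ring
    rw [hpow] at hn ⊢
    rw [Finset.sum_range_succ, add_comm (∑ j ∈ Finset.range K, _), ← add_assoc]
    have hfirst : Real.exp (-(τ / 5)) ≤ Real.exp (-(β / 5)) := by gcongr
    calc _ ≤ Real.exp (-(β / 5)) + K * Real.exp (-(β / 5)) := by
          refine le_trans (measureReal_mono ?_) ((measureReal_union_le _ _).trans (add_le_add
            ((processLaw_real_pool₃_halving_le s (hβ.trans hβτ) (by omega) t₀).trans hfirst)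
            (ih (by omega) (t₀ + (60 * τ + 1)))))
          exact fun x hx =>
            (lt_or_ge (τ ^ 2) (unburntCount (pathGraph (n + 1)) x (t₀ + (60 * τ + 1)))).imp
              (fun h => ⟨hx.1, h⟩) fun h => ⟨h, hx.2⟩
      _ = (K + 1 : ℕ) * Real.exp (-(β / 5)) := by
          push_cast
          ring

lemma burning_add_eq_univ_of_unburntCount_le (hM : M ≤ n)
    (h : unburntCount (pathGraph (n + 1)) x t ≤ M) :
    burning (pathGraph (n + 1)) x (t + M) = Set.univ := by
  refine Set.eq_univ_of_forall fun v => by_contra fun hv => ?_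
  have hsub : (spread (pathGraph (n + 1)))^[M] {v} ⊆ (burning (pathGraph (n + 1)) x t)ᶜ :=
    (disjoint_iterate_spread_burning (Set.disjoint_singleton_left.2 hv)).subset_compl_right
  have := succ_le_ncard_iterate_spread_pathGraph_singleton hM v
  have := Set.ncard_le_ncard hsub
  rw [unburntCount] at h
  omega

lemma processLaw_real_pool₃_lt_burningTime_le (s : Timing) (hβ : 41 ≤ β) (hβn : 40 * β ^ 2 ≤ n)
    (hnβ : n + 1 ≤ β ^ 4) :
    (processLaw (pool₃ s (pathGraph (n + 1)))).real
      {x | 122 * β ^ 2 < burningTime (pathGraph (n + 1)) x} ≤ β * Real.exp (-(β / 5)) := by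
  set K := Nat.clog 2 β
  have hβK : β ≤ 2 ^ K := Nat.le_pow_clog one_lt_two β
  have hK : K ≤ β := Nat.clog_le_of_le_pow Nat.lt_two_pow_self.le
  have hKβ : 2 ^ K ≤ 2 * β := by
    have hpred : 2 ^ (K - 1) < β := Nat.pow_pred_clog_lt_self one_lt_two (by omega)
    have hK₀ : 1 ≤ K := Nat.clog_pos one_lt_two (by omega)
    rw [← Nat.sub_add_cancel hK₀, pow_succ']
    omega
  have hrounds : ∑ j ∈ Finset.range K, (60 * (β * 2 ^ j) + 1) ≤ 121 * β ^ 2 :=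
    calc _ = 60 * β * ∑ j ∈ Finset.range K, 2 ^ j + K := by
          simp [Finset.sum_add_distrib, Finset.mul_sum, mul_assoc]
      _ ≤ 60 * β * 2 ^ K + β := by
          gcongr
          exact (Nat.geomSum_lt le_rfl fun k hk => Finset.mem_range.1 hk).le
      _ ≤ 60 * β * (2 * β) + β * β := by
          gcongr
          exact Nat.le_mul_self β
      _ = 121 * β ^ 2 := by ring
  refine (measureReal_mono fun x hx => ?_).trans
    ((processLaw_real_pool₃_iterate_halving_le s hβ K (by nlinarith) 0).trans (by gcongr))
  refine ⟨?_, ?_⟩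
  · calc unburntCount (pathGraph (n + 1)) x 0 ≤ n + 1 := by
          simpa [unburntCount] using Set.ncard_le_card (burning (pathGraph (n + 1)) x 0)ᶜ
      _ ≤ β ^ 4 := hnβ
      _ = (β * β) ^ 2 := by ring
      _ ≤ _ := by gcongr
  · by_contra! h
    have := (burningTime_le_iff (pathGraph_preconnected _)).2
      (burning_add_eq_univ_of_unburntCount_le (by omega) h)
    rw [Set.mem_ofPred_eq] at hx
    omega

end Phases

/-- The order of magnitude `√(x log x / 2)` of the burning times of the first two processes on the
path with `x` vertices. -/
noncomputable def uniformScale (x : ℝ) : ℝ := √(x * Real.log x / 2)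

section UniformScale

variable {x c u : ℝ}

lemma uniformScale_nonneg (x : ℝ) : 0 ≤ uniformScale x := Real.sqrt_nonneg _

lemma uniformScale_sq (hx : 1 ≤ x) : uniformScale x ^ 2 = x * Real.log x / 2 := by
  have := Real.log_nonneg hx
  exact Real.sq_sqrt (by positivity)

lemma eventually_sqrt_le_uniformScale : ∀ᶠ x in atTop, √x ≤ uniformScale x := by
  filter_upwards [Real.tendsto_log_atTop.eventually_ge_atTop 2, eventually_ge_atTop 0]
    with x hlog hx
  exact Real.sqrt_le_sqrt (by nlinarith)

lemma tendsto_uniformScale : Tendsto uniformScale atTop atTop :=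
  tendsto_atTop_mono' _ eventually_sqrt_le_uniformScale Real.tendsto_sqrt_atTop

lemma isLittleO_uniformScale_rpow {a : ℝ} (ha : 1 / 2 < a) :
    uniformScale =o[atTop] fun x : ℝ => x ^ a := by
  refine Asymptotics.IsLittleO.of_pow (n := 2) ?_ two_ne_zero
  have hlog := ((Asymptotics.isBigO_refl (fun x : ℝ => x) atTop).mul_isLittleO
    (isLittleO_log_rpow_atTop (by linarith : 0 < 2 * a - 1))).const_mul_left (1 / 2)
  refine hlog.congr' ?_ ?_ <;> filter_upwards [eventually_ge_atTop 1] with x hx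
  · rw [Pi.pow_apply, uniformScale_sq hx]
    ring
  · have hx₀ : 0 < x := by linarith
    rw [Pi.pow_apply, ← Real.rpow_one_add' hx₀.le (by linarith), ← Real.rpow_mul_natCast hx₀.le]
    congr 1
    push_cast
    ring

lemma eventually_const_mul_uniformScale_le (c : ℝ) : ∀ᶠ x in atTop, c * uniformScale x ≤ x := by
  have h := (isLittleO_uniformScale_rpow (a := 1) (by norm_num)).const_mul_left c
  filter_upwards [h.bound one_pos, eventually_ge_atTop 0] with x hx hx₀
  rw [Real.rpow_one, one_mul, Real.norm_of_nonneg hx₀] at hx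
  exact (Real.le_norm_self _).trans hx

lemma exp_neg_div_le_rpow (hx : 1 ≤ x) (h : c * uniformScale x ^ 2 ≤ u) :
    Real.exp (-(u / x)) ≤ x ^ (-(c / 2)) := by
  have hx₀ : 0 < x := by linarith
  rw [Real.rpow_def_of_pos hx₀, Real.exp_le_exp, mul_neg, neg_le_neg_iff, le_div_iff₀ hx₀]
  calc Real.log x * (c / 2) * x = c * uniformScale x ^ 2 := by
        rw [uniformScale_sq hx]
        ring
    _ ≤ u := h

lemma exp_div_le_rpow (hx : 1 ≤ x) (h : u ≤ c * uniformScale x ^ 2) :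
    Real.exp (u / x) ≤ x ^ (c / 2) := by
  have hx₀ : 0 < x := by linarith
  rw [Real.rpow_def_of_pos hx₀, Real.exp_le_exp, div_le_iff₀ hx₀]
  calc u ≤ c * uniformScale x ^ 2 := h
    _ = Real.log x * (c / 2) * x := by
        rw [uniformScale_sq hx]
        ring

lemma exp_neg_div_add_mul_exp_neg_div_le {δ T L J : ℝ} (hx : 1 ≤ x) (hδ : 0 < δ) (hJ : 0 ≤ J)
    (hsqrt : √x ≤ uniformScale x) (hT : (1 + δ) * uniformScale x ≤ T)
    (hL : δ * uniformScale x ≤ L) :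
    2 * J * Real.exp (-(T ^ 2 / (2 * x))) + (x / L + 1) * Real.exp (-(T ^ 2 / x)) ≤
      2 * J * x ^ (-(1 / 4) : ℝ) + (1 / δ + 1) * x ^ (-δ) := by
  have hx₀ : 0 < x := by linarith
  have hB := uniformScale_nonneg x
  have hsqrt₁ : 1 ≤ √x := Real.one_le_sqrt.2 hx
  have hTsq : (1 + 2 * δ) * uniformScale x ^ 2 ≤ T ^ 2 :=
    calc (1 + 2 * δ) * uniformScale x ^ 2 ≤ ((1 + δ) * uniformScale x) ^ 2 := by
          nlinarith [sq_nonneg (δ * uniformScale x)]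
      _ ≤ T ^ 2 := by gcongr
  have hendpoints : Real.exp (-(T ^ 2 / (2 * x))) ≤ x ^ (-(1 / 4) : ℝ) := by
    rw [← div_div]
    refine (exp_neg_div_le_rpow (c := 1 / 2) hx ?_).trans_eq (by norm_num)
    nlinarith [mul_nonneg hδ.le (sq_nonneg (uniformScale x))]
  have hgrid : x / L + 1 ≤ (1 / δ + 1) * √x :=
    calc x / L + 1 ≤ x / (δ * √x) + √x := by
          gcongr
          exact (mul_le_mul_of_nonneg_left hsqrt hδ.le).trans hL
      _ = (1 / δ + 1) * √x := by
          field_simp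
          rw [Real.sq_sqrt hx₀.le]
          ring
  have hinterior : √x * Real.exp (-(T ^ 2 / x)) ≤ x ^ (-δ) :=
    calc √x * Real.exp (-(T ^ 2 / x)) ≤ x ^ (1 / 2 : ℝ) * x ^ (-((1 + 2 * δ) / 2)) := by
          rw [Real.sqrt_eq_rpow]
          gcongr
          exact exp_neg_div_le_rpow hx hTsq
      _ = x ^ (-δ) := by
          rw [← Real.rpow_add hx₀]
          ring_nf
  calc _ ≤ 2 * J * x ^ (-(1 / 4) : ℝ) + (1 / δ + 1) * √x * Real.exp (-(T ^ 2 / x)) := by gcongr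
    _ ≤ _ := by
        rw [mul_assoc (1 / δ + 1)]
        gcongr

lemma exp_div_div_add_exp_sub_one_le {δ T m : ℝ} (hx : 1 ≤ x) (hδ : 0 ≤ δ) (hδ₁ : δ ≤ 1 / 2)
    (hB : 6 * uniformScale x ≤ δ * x) (hT₀ : 0 < T) (hT : T ≤ (1 - δ) * uniformScale x)
    (hm : x / (4 * T) ≤ m) :
    Real.exp (T ^ 2 / (x - 3 * T)) / m + Real.exp (6 * T ^ 3 / (x * (x - 3 * T))) - 1 ≤
      4 * (uniformScale x / x ^ ((1 + δ) / 2)) +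
        (Real.exp (12 * (uniformScale x / x ^ (2 / 3 : ℝ)) ^ 3) - 1) := by
  have hx₀ : 0 < x := by linarith
  have hTB : T ≤ uniformScale x := by nlinarith [uniformScale_nonneg x]
  have hB₀ : 0 < uniformScale x := hT₀.trans_le hTB
  have hroom : (1 - δ) * x ≤ x - 3 * T := by linarith
  have hroom₀ : x / 2 ≤ x - 3 * T := by nlinarith
  have hexp : Real.exp (T ^ 2 / (x - 3 * T)) ≤ x ^ ((1 - δ) / 2) := by
    have hδ' : 0 < 1 - δ := by linarith
    calc Real.exp (T ^ 2 / (x - 3 * T)) ≤ Real.exp (T ^ 2 / ((1 - δ) * x)) := by gcongr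
      _ ≤ x ^ ((1 - δ) / 2) := by
          rw [← div_div]
          refine exp_div_le_rpow hx ((div_le_iff₀ hδ').2 ?_)
          calc T ^ 2 ≤ ((1 - δ) * uniformScale x) ^ 2 := by gcongr
            _ = _ := by ring
  have hvariance : Real.exp (T ^ 2 / (x - 3 * T)) / m ≤
      4 * (uniformScale x / x ^ ((1 + δ) / 2)) :=
    calc _ ≤ x ^ ((1 - δ) / 2) / (x / (4 * uniformScale x)) := by
          gcongr
          exact le_trans (by gcongr) hm
      _ = 4 * (uniformScale x / x ^ (1 - (1 - δ) / 2)) := by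
          rw [Real.rpow_sub hx₀, Real.rpow_one]
          field_simp
      _ = _ := by ring_nf
  have hcorrelation : 6 * T ^ 3 / (x * (x - 3 * T)) ≤
      12 * (uniformScale x / x ^ (2 / 3 : ℝ)) ^ 3 :=
    calc _ ≤ 6 * uniformScale x ^ 3 / (x * (x / 2)) := by gcongr
      _ = 12 * (uniformScale x / x ^ (2 / 3 : ℝ)) ^ 3 := by
          have hthree : (2 / 3 : ℝ) * (3 : ℕ) = 2 := by norm_num
          rw [div_pow, ← Real.rpow_mul_natCast hx₀.le, hthree, Real.rpow_two]
          field_simp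
          ring
  linarith [Real.exp_le_exp.2 hcorrelation]

end UniformScale

lemma tendsto_succ_cast_atTop : Tendsto (fun n : ℕ => ((n + 1 : ℕ) : ℝ)) atTop atTop :=
  tendsto_natCast_atTop_atTop.comp (tendsto_add_atTop_nat 1)

section UniformBounds

variable {n : ℕ} {pool : (ℕ → Fin (n + 1)) → ℕ → Set (Fin (n + 1))} {δ : ℝ}

lemma IsAdmissible.processLaw_real_lt_burningTime_pathGraph_le
    (hp : IsAdmissible (pathGraph (n + 1)) pool) (hδ : 0 < δ)
    (hsqrt : √((n + 1 : ℕ) : ℝ) ≤ uniformScale (n + 1 : ℕ))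
    (hδB : 2 ≤ δ * uniformScale (n + 1 : ℕ))
    (hB : (1 + 2 * δ) * uniformScale (n + 1 : ℕ) ≤ (n + 1 : ℕ)) :
    (processLaw pool).real {x | (1 + 3 * δ) * uniformScale (n + 1 : ℕ) <
      burningTime (pathGraph (n + 1)) x} ≤
      2 * ⌈(1 + 2 * δ) / δ⌉₊ * ((n + 1 : ℕ) : ℝ) ^ (-(1 / 4) : ℝ) +
        (1 / δ + 1) * ((n + 1 : ℕ) : ℝ) ^ (-δ) := by
  have hN : (1 : ℝ) ≤ (n + 1 : ℕ) := by exact_mod_cast n.succ_pos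
  set B := uniformScale (n + 1 : ℕ)
  set T := ⌈(1 + δ) * B⌉₊
  set L := ⌈δ * B⌉₊
  set J := ⌈(1 + 2 * δ) / δ⌉₊
  have hB₀ : 0 < B := pos_of_mul_pos_right (by linarith) hδ.le
  have hT : (1 + δ) * B ≤ T := Nat.le_ceil _
  have hT' : (T : ℝ) < (1 + δ) * B + 1 := Nat.ceil_lt_add_one (by positivity)
  have hL : δ * B ≤ L := Nat.le_ceil _
  have hL' : (L : ℝ) < δ * B + 1 := Nat.ceil_lt_add_one (by positivity)
  have hTn : (T : ℝ) ≤ (n + 1 : ℕ) := by linarith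
  have hTJ : (T : ℝ) ≤ J * L :=
    calc (T : ℝ) ≤ (1 + 2 * δ) / δ * (δ * B) := by
          rw [div_mul_eq_mul_div, le_div_iff₀ hδ]
          nlinarith
      _ ≤ J * L := by
          gcongr
          exact Nat.le_ceil _
  have hmono : {x | (1 + 3 * δ) * B < burningTime (pathGraph (n + 1)) x} ⊆
      {x | burning (pathGraph (n + 1)) x (T + L) ≠ Set.univ} := fun x hx hburn => by
    have : (burningTime (pathGraph (n + 1)) x : ℝ) ≤ T + L := by
      exact_mod_cast (burningTime_le_iff (pathGraph_preconnected _)).2 hburn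
    rw [Set.mem_ofPred_eq] at hx
    linarith
  have hgrid : ((n / L + 1 : ℕ) : ℝ) ≤ (n + 1 : ℕ) / L + 1 := by
    push_cast
    gcongr
    exact Nat.cast_div_le.trans (by gcongr; linarith)
  calc _ ≤ 2 * J * Real.exp (-((T : ℝ) ^ 2 / (2 * (n + 1 : ℕ)))) +
        (n / L + 1 : ℕ) * Real.exp (-((T : ℝ) ^ 2 / (n + 1 : ℕ))) :=
        (measureReal_mono hmono).trans
          (hp.processLaw_real_burning_pathGraph_ne_univ_le (by exact_mod_cast hTn)
            (Nat.ceil_pos.2 (by linarith)) (by exact_mod_cast hTJ))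
    _ ≤ 2 * J * Real.exp (-((T : ℝ) ^ 2 / (2 * (n + 1 : ℕ)))) +
        ((n + 1 : ℕ) / L + 1) * Real.exp (-((T : ℝ) ^ 2 / (n + 1 : ℕ))) := by gcongr
    _ ≤ _ := exp_neg_div_add_mul_exp_neg_div_le hN hδ J.cast_nonneg hsqrt hT hL

lemma IsAdmissible.processLaw_real_burningTime_pathGraph_lt_le
    (hp : IsAdmissible (pathGraph (n + 1)) pool) (hcard : ∀ x t, n + 1 ≤ (pool x t).ncard + t)
    (hδ : 0 ≤ δ) (hδ₁ : δ ≤ 1 / 2) (hB₂ : 2 ≤ uniformScale (n + 1 : ℕ))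
    (hB : 6 * uniformScale (n + 1 : ℕ) ≤ δ * (n + 1 : ℕ)) :
    (processLaw pool).real {x | burningTime (pathGraph (n + 1)) x <
      (1 - δ) * uniformScale (n + 1 : ℕ)} ≤
      4 * (uniformScale (n + 1 : ℕ) / ((n + 1 : ℕ) : ℝ) ^ ((1 + δ) / 2)) +
        (Real.exp (12 * (uniformScale (n + 1 : ℕ) / ((n + 1 : ℕ) : ℝ) ^ (2 / 3 : ℝ)) ^ 3) - 1) := by
  have hN : (1 : ℝ) ≤ (n + 1 : ℕ) := by exact_mod_cast n.succ_pos
  set B := uniformScale (n + 1 : ℕ)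
  set T := ⌊(1 - δ) * B⌋₊
  set m := (n + 1) / (2 * T)
  have hT : (T : ℝ) ≤ (1 - δ) * B := Nat.floor_le (by nlinarith)
  have hT₀ : 0 < T := Nat.floor_pos.2 (by nlinarith)
  have hTB : (T : ℝ) ≤ B := by nlinarith
  have hTN : (6 * T : ℝ) ≤ (n + 1 : ℕ) := by nlinarith
  have hTn : 6 * T ≤ n + 1 := by exact_mod_cast hTN
  have hmT : 2 * T * m ≤ n + 1 := Nat.mul_div_le _ _
  have hm : ((n + 1 : ℕ) : ℝ) / (4 * T) ≤ m := by
    have hTm : 2 * T ≤ 2 * T * m :=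
      Nat.le_mul_of_pos_right _ (Nat.div_pos (by omega) (by omega))
    have hlt : n + 1 < 2 * T * (m + 1) := Nat.lt_mul_div_succ _ (by omega)
    rw [div_le_iff₀ (by positivity)]
    exact_mod_cast (by linarith [hTm] : n + 1 ≤ m * (4 * T))
  refine (measureReal_mono fun x hx => ?_).trans
    ((hp.processLaw_real_burning_pathGraph_eq_univ_le (m := m) hcard (by omega) hT₀
      (Nat.div_pos (by omega) (by omega)) hmT).trans
      (exp_div_div_add_exp_sub_one_le hN hδ hδ₁ hB (by positivity) hT hm))
  exact (burningTime_le_iff (pathGraph_preconnected _)).1 (Nat.le_floor (le_of_lt hx))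

end UniformBounds

section Negligible

variable {Ω Ω' : ℕ → Type*} [∀ n, MeasurableSpace (Ω n)] [∀ n, MeasurableSpace (Ω' n)]
  {P : ∀ n, Measure (Ω n)} {Q : ∀ n, Measure (Ω' n)} {E F : ∀ n, Set (Ω n)}
  {A A' : ∀ n, Ω n → ℝ} {B C D : ℕ → ℝ}

/-- The probabilities of the events `E n` tend to zero. -/
def Negligible (P : ∀ n, Measure (Ω n)) (E : ∀ n, Set (Ω n)) : Prop :=
  Tendsto (fun n => (P n).real (E n)) atTop (𝓝 0)

/-- `A` differs from the deterministic `B` by more than a factor `1 ± ε` only on negligible events: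
the complementary form of `AASEquiv`, which needs no measurability to be combined. -/
def Concentrates (P : ∀ n, Measure (Ω n)) (A : ∀ n, Ω n → ℝ) (B : ℕ → ℝ) : Prop :=
  ∀ ε : ℝ, 0 < ε → Negligible P fun n => {ω | ε * B n < |A n ω - B n|}

lemma Negligible.of_eventually_le {f : ℕ → ℝ} (hf : Tendsto f atTop (𝓝 0))
    (h : ∀ᶠ n in atTop, (P n).real (E n) ≤ f n) : Negligible P E :=
  squeeze_zero' (Eventually.of_forall fun _ => measureReal_nonneg) h hf

lemma Negligible.union (hE : Negligible P E) (hF : Negligible P F) :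
    Negligible P fun n => E n ∪ F n :=
  .of_eventually_le (by simpa using hE.add hF)
    (Eventually.of_forall fun n => measureReal_union_le _ _)

lemma Negligible.comp_hasLaw [∀ n, IsFiniteMeasure (Q n)] {X : ∀ n, Ω n → Ω' n}
    {E : ∀ n, Set (Ω' n)} (h : Negligible Q E) (hX : ∀ n, HasLaw (X n) (Q n) (P n)) :
    Negligible P fun n => X n ⁻¹' E n := by
  refine .of_eventually_le h (Eventually.of_forall fun n => ENNReal.toReal_mono
    (measure_ne_top _ _) ?_)
  rw [← (hX n).map_eq]
  exact Measure.le_map_apply (hX n).aemeasurable _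

lemma Concentrates.comp_hasLaw [∀ n, IsFiniteMeasure (Q n)] {X : ∀ n, Ω n → Ω' n}
    {A : ∀ n, Ω' n → ℝ} (h : Concentrates Q A B) (hX : ∀ n, HasLaw (X n) (Q n) (P n)) :
    Concentrates P (fun n ω => A n (X n ω)) B :=
  fun ε hε => (h ε hε).comp_hasLaw hX

lemma Concentrates.div (h : Concentrates P A B) (hD : ∀ n, 0 < D n) :
    Concentrates P (fun n ω => A n ω / D n) fun n => B n / D n := by
  refine fun ε hε => (h ε hε).congr fun n => congrArg _ (Set.ext fun ω => ?_)
  simp only [Set.mem_ofPred_eq]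
  rw [← sub_div, abs_div, abs_of_pos (hD n), ← mul_div_assoc, div_lt_div_iff_of_pos_right (hD n)]

variable [∀ n, IsProbabilityMeasure (P n)]

lemma Negligible.mono (h : Negligible P E) (hFE : ∀ᶠ n in atTop, F n ⊆ E n) : Negligible P F :=
  .of_eventually_le h (hFE.mono fun _ hn => measureReal_mono hn)

lemma Negligible.aas (h : Negligible P fun n => (E n)ᶜ) : AAS P E := by
  have hlower : Tendsto (fun n => 1 - P n (E n)ᶜ) atTop (𝓝 1) := by
    have := ENNReal.tendsto_ofReal h
    rw [ENNReal.ofReal_zero] at this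
    simpa using ENNReal.Tendsto.sub tendsto_const_nhds this (Or.inl ENNReal.one_ne_top)
  refine tendsto_of_tendsto_of_tendsto_of_le_of_le hlower tendsto_const_nhds (fun n => ?_)
    fun n => prob_le_one
  rw [tsub_le_iff_right, ← measure_univ (μ := P n), ← Set.union_compl_self (E n)]
  exact measure_union_le _ _

lemma Negligible.aasTheta {c K : ℝ} (hc : 0 < c) (hK : 0 < K)
    (hlower : ∀ n ω, c * B n ≤ A n ω) (hupper : Negligible P fun n => {ω | K * B n < A n ω}) :
    AASTheta P A fun n _ => B n :=
  ⟨c, K, hc, hK, Negligible.aas (hupper.mono (Eventually.of_forall fun n ω hω =>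
    not_le.1 fun h => hω ⟨hlower n ω, h⟩))⟩

lemma Concentrates.congr (h : Concentrates P A B) (hBC : Asymptotics.IsEquivalent atTop B C)
    (hC : ∀ n, 0 ≤ C n) : Concentrates P A C := by
  intro ε hε
  set η := ε / (2 + ε) with hη
  refine (h (ε / 2) (half_pos hε)).mono ?_
  filter_upwards [hBC.isLittleO.bound (by positivity : 0 < η)] with n hn ω hω
  rw [Pi.sub_apply, Real.norm_eq_abs, Real.norm_of_nonneg (hC n)] at hn
  have htriangle := abs_sub_le (A n ω) (B n) (C n)
  have hBC : ε / 2 * B n ≤ ε / 2 * ((1 + η) * C n) := by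
    gcongr
    linarith [le_abs_self (B n - C n)]
  have hsplit : ε / 2 * ((1 + η) * C n) = ε * C n - η * C n := by
    rw [hη]
    field_simp
    ring
  simp only [Set.mem_ofPred_eq] at hω ⊢
  linarith

lemma Concentrates.aasEquiv (h : Concentrates P A B) : AASEquiv P A fun n _ => B n :=
  fun ε hε => Negligible.aas ((h ε hε).mono (Eventually.of_forall fun n ω hω =>
    not_le.1 (show ¬|A n ω - B n| ≤ ε * B n from hω)))

lemma Concentrates.aasEquiv_of_concentrates (h : Concentrates P A B) (h' : Concentrates P A' B) :
    AASEquiv P A A' := by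
  intro ε hε
  have hη : 0 < ε / (2 + ε) := by positivity
  refine (((h _ hη).union (h' _ hη)).mono (Eventually.of_forall fun n ω hω => ?_)).aas
  by_contra hcon
  simp only [Set.mem_union, Set.mem_ofPred_eq, not_or, not_lt] at hcon
  obtain ⟨hA, hA'⟩ := hcon
  have hB : 2 * (ε / (2 + ε) * B n) = ε * (B n - ε / (2 + ε) * B n) := by
    field_simp
    ring
  have hA'_lower : B n - ε / (2 + ε) * B n ≤ A' n ω := by linarith [neg_abs_le (A' n ω - B n)]
  have htriangle := abs_sub_le (A n ω) (B n) (A' n ω)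
  rw [abs_sub_comm (B n)] at htriangle
  refine hω (?_ : |A n ω - A' n ω| ≤ ε * A' n ω)
  linarith [mul_le_mul_of_nonneg_left hA'_lower hε.le]

end Negligible

section Processes

variable {pool : ∀ n, (ℕ → Fin (n + 1)) → ℕ → Set (Fin (n + 1))} {ε : ℝ}

lemma negligible_uniformScale_lt_burningTime
    (hp : ∀ n, IsAdmissible (pathGraph (n + 1)) (pool n)) (hε : 0 < ε) :
    Negligible (fun n => processLaw (pool n)) fun n =>
      {x | (1 + ε) * uniformScale (n + 1 : ℕ) < burningTime (pathGraph (n + 1)) x} := by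
  obtain ⟨δ, hδ, rfl⟩ : ∃ δ : ℝ, 0 < δ ∧ 3 * δ = ε := ⟨ε / 3, by positivity, by ring⟩
  have hlim : Tendsto (fun x : ℝ => 2 * ⌈(1 + 2 * δ) / δ⌉₊ * x ^ (-(1 / 4) : ℝ) +
      (1 / δ + 1) * x ^ (-δ)) atTop (𝓝 0) := by
    simpa using ((tendsto_rpow_neg_atTop (by norm_num : (0 : ℝ) < 1 / 4)).const_mul _).add
      ((tendsto_rpow_neg_atTop hδ).const_mul (1 / δ + 1))
  refine .of_eventually_le (hlim.comp tendsto_succ_cast_atTop) ?_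
  filter_upwards [tendsto_succ_cast_atTop.eventually eventually_sqrt_le_uniformScale,
    tendsto_succ_cast_atTop.eventually
      ((tendsto_uniformScale.const_mul_atTop hδ).eventually_ge_atTop 2),
    tendsto_succ_cast_atTop.eventually (eventually_const_mul_uniformScale_le (1 + 2 * δ))]
    with n hsqrt hδB hB
  exact (hp n).processLaw_real_lt_burningTime_pathGraph_le hδ hsqrt hδB hB

lemma negligible_burningTime_lt_uniformScale
    (hp : ∀ n, IsAdmissible (pathGraph (n + 1)) (pool n))
    (hcard : ∀ n x t, n + 1 ≤ (pool n x t).ncard + t) (hε : 0 < ε) :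
    Negligible (fun n => processLaw (pool n)) fun n =>
      {x | burningTime (pathGraph (n + 1)) x < (1 - ε) * uniformScale (n + 1 : ℕ)} := by
  set δ := min ε (1 / 2)
  have hδ : 0 < δ := lt_min hε (by norm_num)
  have hlim : Tendsto (fun x : ℝ => 4 * (uniformScale x / x ^ ((1 + δ) / 2)) +
      (Real.exp (12 * (uniformScale x / x ^ (2 / 3 : ℝ)) ^ 3) - 1)) atTop (𝓝 0) := by
    have hvariance :=
      (isLittleO_uniformScale_rpow (a := (1 + δ) / 2) (by linarith)).tendsto_div_nhds_zero
    have hcorrelation :=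
      (isLittleO_uniformScale_rpow (a := 2 / 3) (by norm_num)).tendsto_div_nhds_zero
    simpa using (hvariance.const_mul 4).add
      (((hcorrelation.pow 3).const_mul 12).rexp.sub_const 1)
  refine .of_eventually_le (hlim.comp tendsto_succ_cast_atTop) ?_
  filter_upwards [tendsto_succ_cast_atTop.eventually (tendsto_uniformScale.eventually_ge_atTop 2),
    tendsto_succ_cast_atTop.eventually (eventually_const_mul_uniformScale_le (6 / δ))]
    with n hB₂ hB
  refine (measureReal_mono fun x hx => ?_).trans
    ((hp n).processLaw_real_burningTime_pathGraph_lt_le (hcard n) hδ.le (min_le_right _ _) hB₂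
      (by rwa [div_mul_eq_mul_div, div_le_iff₀' hδ] at hB))
  exact lt_of_lt_of_le hx (mul_le_mul_of_nonneg_right (by linarith [min_le_left ε (1 / 2)])
    (uniformScale_nonneg _))

lemma concentrates_burningTime_pathGraph
    (hp : ∀ n, IsAdmissible (pathGraph (n + 1)) (pool n))
    (hcard : ∀ n x t, n + 1 ≤ (pool n x t).ncard + t) :
    Concentrates (fun n => processLaw (pool n)) (fun n x => burningTime (pathGraph (n + 1)) x)
      fun n => uniformScale (n + 1 : ℕ) := by
  refine fun ε hε => ((negligible_uniformScale_lt_burningTime hp hε).union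
    (negligible_burningTime_lt_uniformScale hp hcard hε)).mono
      (Eventually.of_forall fun n x hx => ?_)
  simp only [Set.mem_union, Set.mem_ofPred_eq, lt_abs] at hx ⊢
  exact hx.imp (fun h => by linarith) fun h => by linarith

lemma tendsto_nat_sqrt_atTop : Tendsto Nat.sqrt atTop atTop :=
  tendsto_atTop_atTop.2 fun k => ⟨k ^ 2, fun _ h => Nat.le_sqrt'.2 h⟩

lemma negligible_lt_burningTime_pool₃ (s : Timing) :
    Negligible (fun n => processLaw (pool₃ s (pathGraph (n + 1)))) fun n =>
      {x | 244 * √((n + 1 : ℕ) : ℝ) < burningTime (pathGraph (n + 1)) x} := by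
  have hr : Tendsto (fun n : ℕ => (n + 1).sqrt.sqrt) atTop atTop :=
    tendsto_nat_sqrt_atTop.comp (tendsto_nat_sqrt_atTop.comp (tendsto_add_atTop_nat 1))
  have hβ : Tendsto (fun n : ℕ => (n + 1).sqrt.sqrt + 1) atTop atTop :=
    (tendsto_add_atTop_nat 1).comp hr
  have hlim : Tendsto (fun b : ℝ => b * Real.exp (-(b / 5))) atTop (𝓝 0) := by
    have := ((Real.tendsto_pow_mul_exp_neg_atTop_nhds_zero 1).comp
      (tendsto_id.atTop_div_const (by norm_num : (0 : ℝ) < 5))).const_mul 5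
    rw [mul_zero] at this
    refine this.congr fun b => ?_
    simp only [Function.comp_apply, pow_one, id_eq]
    ring
  refine .of_eventually_le (hlim.comp (tendsto_natCast_atTop_atTop.comp hβ)) ?_
  filter_upwards [hr.eventually_ge_atTop 40] with n hn
  set q := (n + 1).sqrt
  set r := q.sqrt
  have hq : q ^ 2 ≤ n + 1 := Nat.sqrt_le' _
  have hq' : n + 1 < (q + 1) ^ 2 := Nat.lt_succ_sqrt' _
  have hrq : r ^ 2 ≤ q := Nat.sqrt_le' _
  have hrq' : q < (r + 1) ^ 2 := Nat.lt_succ_sqrt' _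
  have hβq : (r + 1) ^ 2 ≤ 2 * q := by nlinarith
  have hnβ : n + 1 ≤ (r + 1) ^ 4 :=
    calc n + 1 ≤ (q + 1) ^ 2 := hq'.le
      _ ≤ ((r + 1) ^ 2) ^ 2 := Nat.pow_le_pow_left hrq' 2
      _ = (r + 1) ^ 4 := by ring
  refine (measureReal_mono fun x hx => ?_).trans
    (processLaw_real_pool₃_lt_burningTime_le (β := r + 1) s (by omega) (by nlinarith) hnβ)
  have hqN : (q : ℝ) ≤ √((n + 1 : ℕ) : ℝ) := Real.nat_sqrt_le_real_sqrt
  have hβN : ((122 * (r + 1) ^ 2 : ℕ) : ℝ) ≤ 244 * √((n + 1 : ℕ) : ℝ) :=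
    calc ((122 * (r + 1) ^ 2 : ℕ) : ℝ) ≤ (122 * (2 * q) : ℕ) := by gcongr
      _ = 244 * (q : ℝ) := by
          push_cast
          ring
      _ ≤ _ := by gcongr
  exact Nat.cast_lt.1 (hβN.trans_lt hx)

end Processes

section Paths

variable {Ω : ℕ → Type*} [∀ n, MeasurableSpace (Ω n)] {P : ∀ n, Measure (Ω n)}
  {X : ∀ n, Ω n → ℕ → Fin (n + 1)} {pool : ∀ n, (ℕ → Fin (n + 1)) → ℕ → Set (Fin (n + 1))}

lemma burningNumber_pathGraph_pos (s : Timing) (n : ℕ) :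
    (0 : ℝ) < burningNumber s (pathGraph (n + 1)) :=
  (Real.sqrt_pos.2 (by positivity)).trans_le (sqrt_le_burningNumber_pathGraph s n)

lemma isEquivalent_burningNumber_pathGraph (s : Timing) :
    Asymptotics.IsEquivalent atTop (fun n : ℕ => (burningNumber s (pathGraph (n + 1)) : ℝ))
      fun n => √((n + 1 : ℕ) : ℝ) := by
  have hsqrt := Real.tendsto_sqrt_atTop.comp tendsto_succ_cast_atTop
  refine Asymptotics.IsBigO.trans_isLittleO (g := fun _ : ℕ => (1 : ℝ)) ?_
    ((Asymptotics.isLittleO_const_left_of_ne one_ne_zero).2 (tendsto_norm_atTop_atTop.comp hsqrt))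
  refine Asymptotics.IsBigO.of_bound 1 (Eventually.of_forall fun n => ?_)
  rw [Pi.sub_apply, Real.norm_of_nonneg (sub_nonneg.2 (sqrt_le_burningNumber_pathGraph s n))]
  linarith [burningNumber_pathGraph_le s n, norm_one (α := ℝ)]

lemma concentrates_bPath (hp : ∀ n, IsAdmissible (pathGraph (n + 1)) (pool n))
    (hcard : ∀ n x t, n + 1 ≤ (pool n x t).ncard + t)
    (hX : ∀ n, HasLaw (X n) (processLaw (pool n)) (P n)) :
    Concentrates P (bPath X) fun n => √(((n + 1 : ℕ) : ℝ) * Real.log ((n + 1 : ℕ) : ℝ) / 2) :=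
  (concentrates_burningTime_pathGraph hp hcard).comp_hasLaw hX

lemma negligible_lt_bPath_pool₃ {s : Timing}
    (hX : ∀ n, HasLaw (X n) (processLaw (pool₃ s (pathGraph (n + 1)))) (P n)) :
    Negligible P fun n => {ω | 244 * √((n + 1 : ℕ) : ℝ) < bPath X n ω} :=
  (negligible_lt_burningTime_pool₃ s).comp_hasLaw hX

variable [∀ n, IsProbabilityMeasure (P n)]

lemma Concentrates.cPath (s : Timing) (h : Concentrates P (bPath X) fun n =>
      √(((n + 1 : ℕ) : ℝ) * Real.log ((n + 1 : ℕ) : ℝ) / 2)) :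
    Concentrates P (cPath s X) fun n => √(Real.log ((n + 1 : ℕ) : ℝ) / 2) := by
  refine (h.div (burningNumber_pathGraph_pos s)).congr ?_ fun n => Real.sqrt_nonneg _
  refine ((Asymptotics.IsEquivalent.refl).div (isEquivalent_burningNumber_pathGraph s)).congr_right
    (Eventually.of_forall fun n => ?_)
  have hN : (0 : ℝ) < (n + 1 : ℕ) := by positivity
  rw [Pi.div_apply, ← Real.sqrt_div' _ hN.le]
  congr 1
  field_simp

lemma aasTheta_bPath_pool₃ {s : Timing}
    (hX : ∀ n, HasLaw (X n) (processLaw (pool₃ s (pathGraph (n + 1)))) (P n)) :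
    AASTheta P (bPath X) fun n _ => √((n + 1 : ℕ) : ℝ) :=
  Negligible.aasTheta one_pos (by norm_num)
    (fun n ω => (one_mul _).trans_le (sqrt_le_burningTime_pathGraph (X n ω)))
    (negligible_lt_bPath_pool₃ hX)

lemma aasTheta_cPath_pool₃ {s : Timing}
    (hX : ∀ n, HasLaw (X n) (processLaw (pool₃ s (pathGraph (n + 1)))) (P n)) :
    AASTheta P (cPath s X) fun _ _ => 1 := by
  refine Negligible.aasTheta (c := 1 / 2) (K := 244) (by norm_num) (by norm_num) (fun n ω => ?_)
    ((negligible_lt_bPath_pool₃ hX).mono (Eventually.of_forall fun n ω hω => ?_))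
  · have hN : 1 ≤ √((n + 1 : ℕ) : ℝ) := Real.one_le_sqrt.2 (by exact_mod_cast n.succ_pos)
    have hb : √((n + 1 : ℕ) : ℝ) ≤ bPath X n ω := sqrt_le_burningTime_pathGraph (X n ω)
    rw [cPath, le_div_iff₀ (burningNumber_pathGraph_pos s n)]
    linarith [burningNumber_pathGraph_le s n]
  · rw [Set.mem_ofPred_eq, mul_one, cPath, lt_div_iff₀ (burningNumber_pathGraph_pos s n)] at hω
    exact (mul_le_mul_of_nonneg_left (sqrt_le_burningNumber_pathGraph s n)
      (by norm_num)).trans_lt hω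

end Paths

end Burning

theorem theorem1p4 (s : Burning.Timing)
    {Ω : ℕ → Type*} [∀ n, MeasurableSpace (Ω n)]
    (P : ∀ n, Measure (Ω n)) [∀ n, IsProbabilityMeasure (P n)]
    (X₁ X₂ X₃ : ∀ n, Ω n → ℕ → Fin (n + 1))
    (hX₁ : ∀ n, HasLaw (X₁ n) (Burning.processLaw Burning.pool₁) (P n))
    (hX₂ : ∀ n, HasLaw (X₂ n) (Burning.processLaw Burning.pool₂) (P n))
    (hX₃ : ∀ n, HasLaw (X₃ n)
      (Burning.processLaw (Burning.pool₃ s (SimpleGraph.pathGraph (n + 1)))) (P n)) :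
    (Burning.AASEquiv P (Burning.bPath X₁) (Burning.bPath X₂) ∧
      Burning.AASEquiv P (Burning.bPath X₁)
        (fun n _ => √(((n + 1 : ℕ) : ℝ) * Real.log ((n + 1 : ℕ) : ℝ) / 2)) ∧
      Burning.AASEquiv P (Burning.bPath X₂)
        (fun n _ => √(((n + 1 : ℕ) : ℝ) * Real.log ((n + 1 : ℕ) : ℝ) / 2)) ∧
      Burning.AASEquiv P (Burning.cPath s X₁) (Burning.cPath s X₂) ∧
      Burning.AASEquiv P (Burning.cPath s X₁)
        (fun n _ => √(Real.log ((n + 1 : ℕ) : ℝ) / 2)) ∧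
      Burning.AASEquiv P (Burning.cPath s X₂)
        (fun n _ => √(Real.log ((n + 1 : ℕ) : ℝ) / 2))) ∧
    (Burning.AASTheta P (Burning.bPath X₃) (fun n _ => √((n + 1 : ℕ) : ℝ)) ∧
      Burning.AASTheta P (Burning.cPath s X₃) (fun _ _ => 1)) := by
  have h₁ := Burning.concentrates_bPath (fun _ => Burning.isAdmissible_pool₁ _)
    (fun n x t => by simpa using Burning.card_le_ncard_pool₁_add x t) hX₁
  have h₂ := Burning.concentrates_bPath (fun _ => Burning.isAdmissible_pool₂ _)
    (fun n x t => by simpa using Burning.card_le_ncard_pool₂_add x t) hX₂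
  have h₁' := h₁.cPath s
  have h₂' := h₂.cPath s
  exact ⟨⟨h₁.aasEquiv_of_concentrates h₂, h₁.aasEquiv, h₂.aasEquiv,
    h₁'.aasEquiv_of_concentrates h₂', h₁'.aasEquiv, h₂'.aasEquiv⟩,
    Burning.aasTheta_bPath_pool₃ hX₃, Burning.aasTheta_cPath_pool₃ hX₃⟩
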